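/- Let $Q(\omega)=\frac{\omega^3}{2}-\frac{\omega}{6}-\frac1{27}$ and consider $\Sigma=\mathbb R^2$ with Eddington–Finkelstein coordinates $(u,\omega)$, where $\omega=\frac1r-\frac13$, and with the metric $g_\Sigma=2\,du\,d\omega-2Q(\omega)\,du^2$; the metric $g_\Sigma-g_{S^2}$ on $\Sigma\times S^2$ is conformal to the Schwarzschild metric. Let $H_\Sigma=\Omega(U+Q(\omega)\Omega)$ be the geodesic Hamiltonian of $g_\Sigma$, where $(U,\Omega)$ are the momenta conjugate to $(u,\omega)$, and consider a null geodesic of $g_\Sigma-g_{S^2}$ with affine parameter $s$ in an open interval $I\ni s_0$, i.e. a solution of Hamilton's equations of $H_\Sigma-H_{S^2}$ on which $H_\Sigma-H_{S^2}=0$ (here $H_{S^2}$ is the geodesic Hamiltonian of the unit sphere). In particular $\frac{du}{ds}=\Omega$. Let $H$ and $U$ be the values of $H_\Sigma$ and of the momentum $U$ at $s_0$ (both are constant along the geodesic), assume that the geodesic is generic, that is $H>0$, $U\neq0$ and $8H-27U^2\ne0$, and put $z=s\sqrt{H/2}$. Then there are a lattice $L\subset\mathbb C$ with invariants $g_2=\frac43$,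 $g_3=\frac{8H-54U^2}{27H}$, points $z_0,z_1,z_2\in\mathbb C$ and a meromorphic function $F$ on $\mathbb C$, periodic with respect to $L$, such that: 1. For all $s\in I$: $z-z_0\notin L$, $\;\omega=\wp(z-z_0;g_2,g_3)$ and $\frac{d\omega}{dz}=\wp'(z-z_0;g_2,g_3)$. 2. The one-form $F\,dz$ on the elliptic curve $\mathbb C/L$ has exactly two poles: a simple pole at $z_1$ with residue $2$ and a double pole at $z_2$ with residue $-2$. For all $s\in I$ the point $z=s\sqrt{H/2}$ is not in $(z_1+L)\cup(z_2+L)$, and $\Omega\,ds=F\,dz$ along the geodesic; so $F\,dz$ is the complexification of $du=\Omega\,ds$. 3. Let $D=\mathbb C\setminus\big((z_1+L)\cup(z_2+L)\big)$. The coordinate $u$ is a well-defined function of $z\in D$ with values in $\mathbb C/4\pi i\mathbb Z$: there is exactly one function $v:D\to\mathbb C/4\pi i\mathbb Z$ which near each point of $D$ is the class of a holomorphic function with derivative $F$, and which along the geodesic is the class of $u$. 4. Consequently $e^{u/2}$ is a well-defined holomorphic function of the complex parameter $z$ away from the double poles of $du$: there is a holomorphic function $P$ on $\mathbb C\setminus(z_2+L)$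 with $P(z)=e^{v(z)/2}$ for all $z\in D$, and in particular $P=e^{u/2}$ along the geodesic. -/

import Mathlib

open Topology

noncomputable section

namespace Schwarzschild

/-- The cubic `Q(ω) = ω³/2 - ω/6 - 1/27`. -/
def Q (ω : ℝ) : ℝ := ω ^ 3 / 2 - ω / 6 - 1 / 27

/-- The string metric `g_Σ = 2 du dω - 2 Q(ω) du²` in the Eddington-Finkelstein coordinates
`(u, ω) ∈ ℝ²`, as a quadratic form in the tangent vector `(du, dω)`. Here `ω = 1/r - 1/3`. -/
def stringMetric (ω du dω : ℝ) : ℝ := 2 * du * dω - 2 * Q ω * du ^ 2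

/-- In the coordinates `(t, r)`, with `ω = 1/r - 1/3` and
`u = t + r - 1 + (1/2) ln ((r - 1)²)`, the string metric is the conformally rescaled
Schwarzschild metric on the `(t, r)` plane. -/
theorem stringMetric_eq_schwarzschild (r dt dr : ℝ) (h0 : r ≠ 0) (h1 : r - 1 ≠ 0) :
    stringMetric (1 / r - 1 / 3) (dt + r * dr / (r - 1)) (-dr / r ^ 2) =
      (r - 1) / r ^ 3 * (dt + r * dr / (r - 1)) * (dt - r * dr / (r - 1)) := by
  unfold stringMetric Q
  field_simp
  ring

/-- The Hamiltonian `H_Σ = Ω (U + Q(ω) Ω)` of the geodesics of the string, on the cotangent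
bundle with canonical one-form `U du + Ω dω`. -/
def stringHamiltonian (_u ω U Ω : ℝ) : ℝ := Ω * (U + Q ω * Ω)

/-- The string Hamiltonian is half the metric, under the identification of the tangent vector
`(a, b)` with the covector `(U, Ω) = (b - 2 Q(ω) a, a)` given by the metric. -/
theorem stringHamiltonian_eq_half_metric (u ω a b : ℝ) :
    stringHamiltonian u ω (b - 2 * Q ω * a) a = stringMetric ω a b / 2 := by
  unfold stringHamiltonian stringMetric
  ring

/-- The Hamiltonian `H_2 = |p|²/2` of the geodesics of the unit two-sphere in `ℝ³`. -/
def sphereHamiltonian (p : EuclideanSpace ℝ (Fin 3)) : ℝ := ‖p‖ ^ 2 / 2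

/-- The curve `s ↦ (u, ω, x; U, Ω, p)` in the cotangent bundle of `Σ × S²` is, for `s ∈ I`, a
null geodesic of the metric `g_Σ - g_2`, with affine parameter `s`: it solves Hamilton's
equations of `H_Σ - H_2`, and `H_Σ - H_2` vanishes on it. The cotangent bundle of the sphere is
`{(x, p) : |x| = 1, x · p = 0}`, on which the Hamiltonian flow of `-H_2` is
`x' = -p`, `p' = |p|² x`. -/
structure IsNullGeodesic (I : Set ℝ) (u ω U Ω : ℝ → ℝ)
    (x p : ℝ → EuclideanSpace ℝ (Fin 3)) : Prop where
  hamilton_u : ∀ s ∈ I,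
    HasDerivAt u (deriv (fun a => stringHamiltonian (u s) (ω s) a (Ω s)) (U s)) s
  hamilton_ω : ∀ s ∈ I,
    HasDerivAt ω (deriv (fun a => stringHamiltonian (u s) (ω s) (U s) a) (Ω s)) s
  hamilton_U : ∀ s ∈ I,
    HasDerivAt U (-deriv (fun a => stringHamiltonian a (ω s) (U s) (Ω s)) (u s)) s
  hamilton_Ω : ∀ s ∈ I,
    HasDerivAt Ω (-deriv (fun a => stringHamiltonian (u s) a (U s) (Ω s)) (ω s)) s
  norm_x : ∀ s ∈ I, ‖x s‖ = 1
  inner_x_p : ∀ s ∈ I, inner ℝ (x s) (p s) = 0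
  hamilton_x : ∀ s ∈ I, HasDerivAt x (-p s) s
  hamilton_p : ∀ s ∈ I, HasDerivAt p (‖p s‖ ^ 2 • x s) s
  null : ∀ s ∈ I, stringHamiltonian (u s) (ω s) (U s) (Ω s) - sphereHamiltonian (p s) = 0

/-- The genericity condition on the energy `H` and the momentum `U`. -/
def Generic (H U : ℝ) : Prop := 0 < H ∧ U ≠ 0 ∧ 8 * H - 27 * U ^ 2 ≠ 0

/-- The rescaled affine parameter `z = s √(H/2)`, as a complex number. -/
def zParam (H s : ℝ) : ℂ := ((s * √(H / 2) : ℝ) : ℂ)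

/-- The lattice `4πiℤ` in `ℂ`. -/
def period : AddSubgroup ℂ := AddSubgroup.zmultiples (4 * Real.pi * Complex.I)

/-- `ρ` is the residue at `a` of the one-form `f dz`:
`∮ f dz = 2πi ρ` over all sufficiently small circles around `a`. -/
def HasResidue (f : ℂ → ℂ) (a ρ : ℂ) : Prop :=
  ∀ᶠ R in 𝓝[>] (0 : ℝ), (∮ z in C(a, R), f z) = 2 * Real.pi * Complex.I * ρ

/-- The complement of the cosets `z₁ + L` and `z₂ + L` in `ℂ`. -/
def regularSet (L : PeriodPair) (z₁ z₂ : ℂ) : Set ℂ :=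
  {z | z - z₁ ∉ L.lattice ∧ z - z₂ ∉ L.lattice}

/-- `f dz` is a meromorphic one-form on the elliptic curve `ℂ / L`, having exactly two poles
there: a simple one at `z₁` with residue `2` and a double one at `z₂` with residue `-2`. -/
structure HasSimpleAndDoublePole (L : PeriodPair) (f : ℂ → ℂ) (z₁ z₂ : ℂ) : Prop where
  periodic : ∀ l ∈ L.lattice, ∀ z, f (z + l) = f z
  meromorphic : Meromorphic f
  analyticAt : ∀ z ∈ regularSet L z₁ z₂, AnalyticAt ℂ f z
  order_simple : ∀ z, z - z₁ ∈ L.lattice → meromorphicOrderAt f z = (-1 : ℤ)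
  order_double : ∀ z, z - z₂ ∈ L.lattice → meromorphicOrderAt f z = (-2 : ℤ)
  residue_simple : ∀ z, z - z₁ ∈ L.lattice → HasResidue f z 2
  residue_double : ∀ z, z - z₂ ∈ L.lattice → HasResidue f z (-2)

/-- `v` is a holomorphic function on `D ⊆ ℂ` with values in `ℂ / 4πiℤ` and `dv = f dz`: near
each point of `D` it is the class of a holomorphic function with derivative `f`. -/
def HasDifferential (D : Set ℂ) (v : D → ℂ ⧸ period) (f : ℂ → ℂ) : Prop :=
  ∀ z ∈ D, ∃ g : ℂ → ℂ, ∀ᶠ w in 𝓝 z,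
    HasDerivAt g (f w) w ∧ ∀ hw : w ∈ D, v ⟨w, hw⟩ = (g w : ℂ ⧸ period)

/-- `v` is a continuation to `D ⊆ ℂ` of the coordinate `u`, as a function of the complex
parameter `z` with values in `ℂ / 4πiℤ`: it has differential `f dz`, and along the geodesic,
where `z = s √(H/2)` with `s ∈ I`, it is the class of `u`. -/
def IsContinuation (I : Set ℝ) (H : ℝ) (u : ℝ → ℝ) (D : Set ℂ) (f : ℂ → ℂ)
    (v : D → ℂ ⧸ period) : Prop :=
  HasDifferential D v f ∧
    ∀ s ∈ I, ∃ h : zParam H s ∈ D, v ⟨zParam H s, h⟩ = ((u s : ℂ) : ℂ ⧸ period)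

end Schwarzschild

end

noncomputable section

open Filter Set

/-! Conservation of `U` and of `Ω(U + QΩ) = H` gives `(dω/ds)² = (U + 2QΩ)² = U² + 4HQ(ω)`. With `z
= κs`, `κ² = H/2` and `c = U/κ` this is the Weierstrass cubic `(dω/dz)² = 4ω³ - (4/3)ω - (8/27 -
c²)`, and genericity says exactly that `c ≠ 0` and the cubic is nonsingular. A lattice with these
invariants exists because `E₆²/E₄³` takes every nonnegative real value except `1` on two vertical
lines (`exists_periodPair_g₂_eq_g₃_eq`). Since `℘` maps onto the cubic, `z₀` can be chosen to match
the initial data; ODE uniqueness does the rest (`IsNullGeodesic.weierstrassP_eq`).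

Energy conservation also reads `Ω(dω/ds + U) = 2H`, that is `Ω = κF` with `F = 4/(℘' + c)`. The
factorization `27(℘' + c)(℘' - c) = 4(3℘ - 2)(3℘ + 1)²` locates the poles of `F`: a simple one over
`ω = 2/3` (the horizon `r = 1`) and a double one over `ω = -1/3` (`r = ∞`), both on the branch `℘' =
-c`. Local expansions there give the residues `2` and `-2`.

Hence `F/2` has residues `1` and `-1`. Integrality makes the equation `P' = (F/2)P` solvable by a
single-valued function on the plane minus the poles, and `P` extends over the simple poles, where it
vanishes. Normalized at `s₀`, `P` equals `exp(u/2)` along the geodesic. As `a ↦ exp(a/2)` identifies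
`ℂ/4πiℤ` with `ℂˣ`, the class of `2 log P` is the continuation of `u`, unique because the domain is
connected. -/

theorem eventuallyEq_of_hasDerivAt_contDiffAt {E : Type*} [NormedAddCommGroup E] [NormedSpace ℝ E]
    {v : E → E} {f g : ℝ → E} {t₀ : ℝ} (hv : ContDiffAt ℝ 1 v (f t₀))
    (hf : ∀ᶠ t in 𝓝 t₀, HasDerivAt f (v (f t)) t)
    (hg : ∀ᶠ t in 𝓝 t₀, HasDerivAt g (v (g t)) t) (h : f t₀ = g t₀) : f =ᶠ[𝓝 t₀] g := by
  obtain ⟨K, s, hs, hK⟩ := hv.exists_lipschitzOnWith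
  exact ODE_solution_unique_of_eventually (v := fun _ => v) (s := fun _ => s) (K := K)
    (Eventually.of_forall fun _ => hK)
    (hf.and (hf.self_of_nhds.continuousAt.eventually_mem hs))
    (hg.and (hg.self_of_nhds.continuousAt.eventually_mem (h ▸ hs))) h

/-! ### The map `(℘, ℘')` onto the Weierstrass cubic: differential equation, surjectivity,
injectivity. -/

namespace PeriodPair

variable (L : PeriodPair)

theorem countable_lattice : (L.lattice : Set ℂ).Countable := by
  have : Countable L.lattice := L.latticeEquivProd.toEquiv.countable_iff.mpr inferInstance
  exact this

theorem isPreconnected_compl_of_countable {s : Set ℂ} (hs : s.Countable) : IsPreconnected sᶜ :=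
  (hs.isConnected_compl_of_one_lt_rank (by simp)).isPreconnected

theorem hasDerivAt_weierstrassP {z : ℂ} (hz : z ∉ L.lattice) :
    HasDerivAt L.weierstrassP (L.derivWeierstrassP z) z := by
  have := (L.analyticOnNhd_weierstrassP z hz).differentiableAt.hasDerivAt
  rwa [L.deriv_weierstrassP] at this

theorem eventually_notMem_lattice_nhdsNE (z : ℂ) : ∀ᶠ w in 𝓝[≠] z, w ∉ L.lattice := by
  filter_upwards [self_mem_nhdsWithin, mem_nhdsWithin_of_mem_nhds
    (L.compl_lattice_sdiff_singleton_mem_nhds z)] with w hw hw' h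
  exact hw' ⟨h, hw⟩

theorem eventually_notMem_lattice {z : ℂ} (hz : z ∉ L.lattice) : ∀ᶠ w in 𝓝 z, w ∉ L.lattice :=
  L.isClosed_lattice.isOpen_compl.mem_nhds hz

theorem tendsto_weierstrassP_cobounded {l : ℂ} (hl : l ∈ L.lattice) :
    Tendsto L.weierstrassP (𝓝[≠] l) (Bornology.cobounded ℂ) := by
  rw [tendsto_cobounded_iff_meromorphicOrderAt_neg (L.meromorphic_weierstrassP l),
    L.order_weierstrassP l hl]
  decide

/-- Otherwise `℘` would be constant on the connected complement of the lattice, contradicting its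
pole at `0`. -/
theorem not_eventually_derivWeierstrassP_eq_zero :
    ¬ ∀ z ∉ L.lattice, L.derivWeierstrassP z = 0 := by
  intro h
  have hc : ∀ z ∉ L.lattice, L.weierstrassP z = L.weierstrassP (L.ω₁ / 2) := fun z hz =>
    L.isClosed_lattice.isOpen_compl.is_const_of_deriv_eq_zero
      (isPreconnected_compl_of_countable L.countable_lattice)
      L.analyticOnNhd_weierstrassP.differentiableOn
      (fun w hw => by simpa using h w hw) hz L.ω₁_div_two_notMem_lattice
  have h1 := L.tendsto_weierstrassP_cobounded (zero_mem L.lattice)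
  have h2 : Tendsto L.weierstrassP (𝓝[≠] 0) (𝓝 (L.weierstrassP (L.ω₁ / 2))) := by
    refine tendsto_const_nhds.congr' ?_
    filter_upwards [L.eventually_notMem_lattice_nhdsNE 0] with w hw using (hc w hw).symm
  exact h2.not_tendsto (Metric.disjoint_nhds_cobounded _) h1

/-- Differentiating the cubic relation gives `℘'` times the desired identity. The factor `℘'`
cancels even at its zeros, since analytic functions on a connected set have no zero divisors. -/
theorem hasDerivAt_derivWeierstrassP {z : ℂ} (hz : z ∉ L.lattice) :
    HasDerivAt L.derivWeierstrassP (6 * L.weierstrassP z ^ 2 - L.g₂ / 2) z := by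
  have hd : ∀ w ∉ L.lattice, HasDerivAt L.derivWeierstrassP (deriv L.derivWeierstrassP w) w :=
    fun w hw => (L.analyticOnNhd_derivWeierstrassP w hw).differentiableAt.hasDerivAt
  have hmul : ∀ w ∉ L.lattice, L.derivWeierstrassP w *
      (2 * deriv L.derivWeierstrassP w - (12 * L.weierstrassP w ^ 2 - L.g₂)) = 0 := by
    intro w hw
    have h1 := (hd w hw).pow 2
    have hp := L.hasDerivAt_weierstrassP hw
    have h2 := (((hp.pow 3).const_mul 4).sub (hp.const_mul L.g₂)).sub_const L.g₃
    have h3 := (h1.congr_of_eventuallyEq (f₁ := fun w => 4 * L.weierstrassP w ^ 3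
      - L.g₂ * L.weierstrassP w - L.g₃) (by
        filter_upwards [L.eventually_notMem_lattice hw] with y hy
        simpa using (L.derivWeierstrassP_sq y hy).symm)).unique h2
    norm_num at h3
    linear_combination h3
  have han : AnalyticOnNhd ℂ (fun w => 2 * deriv L.derivWeierstrassP w
      - (12 * L.weierstrassP w ^ 2 - L.g₂)) (L.lattice : Set ℂ)ᶜ := by
    intro w hw
    have h1 := (L.analyticOnNhd_derivWeierstrassP w hw).deriv
    have h2 := L.analyticOnNhd_weierstrassP w hw
    fun_prop
  rcases L.analyticOnNhd_derivWeierstrassP.eq_zero_or_eq_zero_of_mul_eq_zero han hmul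
    (isPreconnected_compl_of_countable L.countable_lattice) with h | h
  · exact absurd h L.not_eventually_derivWeierstrassP_eq_zero
  · have := h z hz
    convert! hd z hz using 1
    linear_combination -this / 2

/-- Liouville: if `x` were omitted, `1/(℘ - x)`, extended by `0` at the poles, would be entire and
periodic, hence constant, though it vanishes at `0` and not at `ω₁/2`. -/
theorem exists_weierstrassP_eq (x : ℂ) : ∃ z ∉ L.lattice, L.weierstrassP z = x := by
  classical
  by_contra! hx
  let f : ℂ → ℂ := fun z => if z ∈ L.lattice then 0 else (L.weierstrassP z - x)⁻¹
  have hf : ∀ z ∉ L.lattice, DifferentiableAt ℂ f z := by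
    intro z hz
    have h1 := ((L.hasDerivAt_weierstrassP hz).differentiableAt.sub_const x).inv
      (sub_ne_zero.mpr (hx z hz))
    refine h1.congr_of_eventuallyEq ?_
    filter_upwards [L.eventually_notMem_lattice hz] with w hw
    simp [f, hw]
  have hd : Differentiable ℂ f := by
    intro z
    by_cases hz : z ∈ L.lattice
    · refine (Complex.analyticAt_of_differentiable_on_punctured_nhds_of_continuousAt ?_
        ?_).differentiableAt
      · filter_upwards [L.eventually_notMem_lattice_nhdsNE z] with w hw using hf w hw
      · rw [continuousAt_iff_punctured_nhds]
        have h1 : Tendsto (fun w => (L.weierstrassP w - x)⁻¹) (𝓝[≠] z) (𝓝 0) := by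
          have := (L.tendsto_weierstrassP_cobounded hz)
          refine tendsto_inv₀_cobounded.comp ?_
          simpa [sub_eq_add_neg, Function.comp_def] using (tendsto_add_const_cobounded (-x)).comp this
        have h0 : f z = 0 := by simp [f, hz]
        rw [h0]
        refine h1.congr' ?_
        filter_upwards [L.eventually_notMem_lattice_nhdsNE z] with w hw
        simp [f, hw]
    · exact hf z hz
  have hper : ∀ z w, w ∈ L.lattice → f (z + w) = f z := by
    intro z w hw
    have : z + w ∈ L.lattice ↔ z ∈ L.lattice := L.lattice.toAddSubgroup.add_mem_cancel_right hw
    simp only [f, this, L.weierstrassP_add_coe z ⟨w, hw⟩]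
  have := hd.apply_eq_apply_of_bounded
    (IsZLattice.isCompact_range_of_periodic L.lattice f hd.continuous hper).isBounded
    (L.ω₁ / 2) 0
  simp only [f, L.ω₁_div_two_notMem_lattice, zero_mem, if_true, if_false, inv_eq_zero,
    sub_eq_zero] at this
  exact hx _ L.ω₁_div_two_notMem_lattice this

theorem exists_weierstrassP_eq_and_derivWeierstrassP_eq {x y : ℂ}
    (h : y ^ 2 = 4 * x ^ 3 - L.g₂ * x - L.g₃) :
    ∃ z ∉ L.lattice, L.weierstrassP z = x ∧ L.derivWeierstrassP z = y := by
  obtain ⟨z, hz, rfl⟩ := L.exists_weierstrassP_eq x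
  rw [← L.derivWeierstrassP_sq z hz] at h
  rcases sq_eq_sq_iff_eq_or_eq_neg.mp h with h | h
  · exact ⟨z, hz, rfl, h.symm⟩
  · exact ⟨-z, by simpa using hz, L.weierstrassP_neg z, by rw [L.derivWeierstrassP_neg, h]⟩

/-- The second order equation of `℘` as an autonomous first order system, with time scaled by `k`.
-/
def weierstrassField (k : ℂ) (q : ℂ × ℂ) : ℂ × ℂ := (k * q.2, k * (6 * q.1 ^ 2 - L.g₂ / 2))

theorem contDiff_weierstrassField (k : ℂ) : ContDiff ℝ 1 (L.weierstrassField k) := by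
  unfold weierstrassField
  fun_prop

theorem hasDerivAt_weierstrassP_line {k b : ℂ} {t : ℝ} (h : (t : ℂ) * k + b ∉ L.lattice) :
    HasDerivAt (fun t : ℝ => (L.weierstrassP (t * k + b), L.derivWeierstrassP (t * k + b)))
      (L.weierstrassField k (L.weierstrassP (t * k + b), L.derivWeierstrassP (t * k + b))) t := by
  have hl : HasDerivAt (fun t : ℝ => (t : ℂ) * k + b) k t := by
    simpa using (Complex.ofRealCLM.hasDerivAt (x := t)).mul_const k |>.add_const b
  have h1 := (L.hasDerivAt_weierstrassP h).comp t hl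
  have h2 := (L.hasDerivAt_derivWeierstrassP h).comp t hl
  convert! h1.prodMk h2 using 1
  simp [weierstrassField, mul_comm]

/-- Equal initial data for the second order equation make the translates of `℘` by `w` and `a` agree
on a real interval, hence by the identity theorem off their poles. The pole at `-a` of one must then
be a pole of the other. -/
theorem sub_mem_lattice_of_weierstrassP_eq {a w : ℂ} (ha : a ∉ L.lattice) (hw : w ∉ L.lattice)
    (h : L.weierstrassP w = L.weierstrassP a)
    (h' : L.derivWeierstrassP w = L.derivWeierstrassP a) : w - a ∈ L.lattice := by
  have hnear : ∀ b ∉ L.lattice, ∀ᶠ t : ℝ in 𝓝 0, (t : ℂ) * 1 + b ∉ L.lattice := by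
    intro b hb
    have : ContinuousAt (fun t : ℝ => (t : ℂ) * 1 + b) 0 := by fun_prop
    exact this.eventually (by simpa using L.eventually_notMem_lattice hb)
  have hode := eventuallyEq_of_hasDerivAt_contDiffAt
    (f := fun t : ℝ => (L.weierstrassP (t * 1 + w), L.derivWeierstrassP (t * 1 + w)))
    (g := fun t : ℝ => (L.weierstrassP (t * 1 + a), L.derivWeierstrassP (t * 1 + a)))
    (t₀ := 0) (L.contDiff_weierstrassField 1).contDiffAt
    ((hnear w hw).mono fun t ht => L.hasDerivAt_weierstrassP_line ht)
    ((hnear a ha).mono fun t ht => L.hasDerivAt_weierstrassP_line ht) (by simp [h, h'])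
  have hfreq : ∃ᶠ z in 𝓝[≠] (0 : ℂ), L.weierstrassP (z + w) = L.weierstrassP (z + a) := by
    have hT : Tendsto (fun t : ℝ => (t : ℂ)) (𝓝[≠] 0) (𝓝[≠] 0) := by
      refine tendsto_nhdsWithin_iff.mpr ⟨?_, ?_⟩
      · exact (Complex.continuous_ofReal.tendsto' 0 0 (by simp)).mono_left nhdsWithin_le_nhds
      · filter_upwards [self_mem_nhdsWithin] with t ht
        simpa using ht
    refine hT.frequently ?_
    refine Eventually.frequently ?_
    filter_upwards [mem_nhdsWithin_of_mem_nhds hode] with t ht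
    simpa using congrArg Prod.fst ht
  set s : Set ℂ := {z | z + w ∈ L.lattice} ∪ {z | z + a ∈ L.lattice} with hs
  have hsc : s.Countable := (L.countable_lattice.preimage (add_left_injective w)).union
    (L.countable_lattice.preimage (add_left_injective a))
  have hsub : ∀ z ∈ sᶜ, z + w ∉ L.lattice ∧ z + a ∉ L.lattice := by
    intro z hz
    simpa [hs, not_or] using hz
  have han : ∀ b z : ℂ, z + b ∉ L.lattice → AnalyticAt ℂ (fun z => L.weierstrassP (z + b)) z :=
    fun b z hz =>
      AnalyticAt.fun_comp (f := fun z => z + b) (L.analyticOnNhd_weierstrassP (z + b) hz) (by fun_prop)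
  have heq := AnalyticOnNhd.eqOn_of_preconnected_of_frequently_eq (U := sᶜ) (z₀ := 0)
    (fun z hz => han w z (hsub z hz).1) (fun z hz => han a z (hsub z hz).2)
    (isPreconnected_compl_of_countable hsc) (by simp [hs, ha, hw]) hfreq
  by_contra hwa
  have hl : Tendsto (fun z => z + a) (𝓝[≠] (-a)) (𝓝[≠] 0) := by
    refine tendsto_nhdsWithin_iff.mpr ⟨?_, ?_⟩
    · exact ((continuous_add_const a).tendsto' (-a) 0 (by simp)).mono_left nhdsWithin_le_nhds
    · filter_upwards [self_mem_nhdsWithin] with t ht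
      simpa [add_eq_zero_iff_eq_neg] using ht
  have h1 := (L.tendsto_weierstrassP_cobounded (zero_mem L.lattice)).comp hl
  have hwa' : -a + w ∉ L.lattice := by rwa [neg_add_eq_sub]
  have h2 : Tendsto (fun z => L.weierstrassP (z + w)) (𝓝[≠] (-a))
      (𝓝 (L.weierstrassP (-a + w))) :=
    (han w (-a) hwa').continuousAt.tendsto.mono_left nhdsWithin_le_nhds
  refine h2.not_tendsto (Metric.disjoint_nhds_cobounded _) (h1.congr' ?_)
  have hcw : ∀ᶠ z in 𝓝 (-a), z + w ∉ L.lattice :=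
    (continuous_add_const w).continuousAt.eventually (L.eventually_notMem_lattice hwa')
  filter_upwards [mem_nhdsWithin_of_mem_nhds hcw,
    hl.eventually (L.eventually_notMem_lattice_nhdsNE 0)] with z hz hz'
  refine (heq ?_).symm
  simp only [hs, mem_compl_iff, mem_union, mem_ofPred_eq, not_or]
  exact ⟨hz, hz'⟩

end PeriodPair

/-! ### Existence of a lattice with given real invariants, by Eisenstein series. -/

section EisensteinSeries

open UpperHalfPlane ModularForm MatrixGroups EisensteinSeries

theorem tendsto_eisensteinSeries_atImInfty {k : ℕ} (hk : 3 ≤ k) (hk2 : Even k) :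
    Tendsto (E hk) atImInfty (𝓝 1) := by
  have hh : (0 : ℝ) < 1 := one_pos
  have hΓ := one_mem_strictPeriods_SL
  have hanal := ModularFormClass.analyticAt_cuspFunction_zero (E hk) hh hΓ
  have hper := SlashInvariantFormClass.periodic_comp_ofComplex (E hk) hΓ
  have h1 := qExpansion_coeff_zero hh hanal hper
  rw [E_qExpansion_coeff_zero hk hk2, ← cuspFunction_apply_zero hh hanal hper] at h1
  rw [h1]
  exact (hanal.continuousAt.tendsto.comp (qParam_tendsto_atImInfty hh)).congr
    (fun τ ↦ SlashInvariantFormClass.eq_cuspFunction (E hk) τ hΓ hh.ne')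

theorem eisensteinSeries_eq_ofReal {k : ℕ} (hk : 3 ≤ k) (hk2 : Even k) (τ : ℍ) {q : ℝ}
    (hq : Complex.exp (2 * Real.pi * Complex.I * τ) = q) :
    E hk τ = ((1 - 2 * k / bernoulli k *
      ∑' n : ℕ+, ArithmeticFunction.sigma (k - 1) n * q ^ (n : ℕ) : ℝ) : ℂ) := by
  rw [q_expansion_bernoulli hk hk2, hq]
  push_cast
  simp

theorem eisensteinSeries_S_smul {k : ℕ} (hk : 3 ≤ k) (τ : ℍ) :
    E hk (ModularGroup.S • τ) = (τ : ℂ) ^ k * E hk τ := by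
  have := SlashInvariantForm.slash_action_eqn'' (E hk)
    (γ := Matrix.SpecialLinearGroup.mapGL ℝ ModularGroup.S) (by simp) τ
  rw [← zpow_natCast, ← ModularGroup.denom_S]
  exact this

theorem eisensteinSeries_vadd {k : ℕ} (hk : 3 ≤ k) (τ : ℍ) : E hk ((1 : ℝ) +ᵥ τ) = E hk τ :=
  SlashInvariantForm.vAdd_apply_of_mem_strictPeriods (E hk) τ one_mem_strictPeriods_SL

/-- The point `x + i eᵗ` of the upper half plane. -/
def verticalPoint (x t : ℝ) : ℍ :=
  ⟨x + Real.exp t * Complex.I, by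
    rw [Complex.add_im, Complex.im_ofReal_mul]; simpa using Real.exp_pos t⟩

theorem coe_verticalPoint (x t : ℝ) :
    (verticalPoint x t : ℂ) = x + Real.exp t * Complex.I := rfl

theorem im_verticalPoint (x t : ℝ) : (verticalPoint x t).im = Real.exp t := by
  rw [← coe_im, coe_verticalPoint, Complex.add_im, Complex.im_ofReal_mul]
  simp

theorem continuous_verticalPoint (x : ℝ) : Continuous (verticalPoint x) := by
  rw [isEmbedding_coe.continuous_iff]
  have : ((↑) : ℍ → ℂ) ∘ verticalPoint x = fun t => x + Real.exp t * Complex.I := rfl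
  rw [this]
  fun_prop

theorem tendsto_verticalPoint_atImInfty (x : ℝ) :
    Tendsto (verticalPoint x) atTop atImInfty := by
  rw [atImInfty, tendsto_comap_iff]
  exact Real.tendsto_exp_atTop.congr fun t => (im_verticalPoint x t).symm

theorem exp_verticalPoint_zero (t : ℝ) :
    Complex.exp (2 * Real.pi * Complex.I * verticalPoint 0 t) =
      ((Real.exp (-(2 * Real.pi * Real.exp t)) : ℝ) : ℂ) := by
  rw [coe_verticalPoint]
  push_cast
  congr 1
  linear_combination 2 * Real.pi * Complex.exp t * Complex.I_mul_I

theorem exp_verticalPoint_half (t : ℝ) :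
    Complex.exp (2 * Real.pi * Complex.I * verticalPoint (1 / 2) t) =
      ((-Real.exp (-(2 * Real.pi * Real.exp t)) : ℝ) : ℂ) := by
  rw [coe_verticalPoint]
  push_cast
  rw [neg_eq_neg_one_mul (Complex.exp _), ← Complex.exp_pi_mul_I, ← Complex.exp_add]
  congr 1
  linear_combination 2 * Real.pi * Complex.exp t * Complex.I_mul_I

theorem coe_verticalPoint_zero_zero : (verticalPoint 0 0 : ℂ) = Complex.I := by
  simp [coe_verticalPoint]

theorem S_smul_verticalPoint_zero_zero :
    ModularGroup.S • verticalPoint 0 0 = verticalPoint 0 0 := by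
  rw [modular_S_smul]
  ext
  simp [coe_verticalPoint_zero_zero]

theorem coe_verticalPoint_half :
    (verticalPoint (1 / 2) (-Real.log 2) : ℂ) = (1 + Complex.I) / 2 := by
  rw [coe_verticalPoint, Real.exp_neg, Real.exp_log two_pos]
  push_cast
  ring

/-- This is `1 - 1/τ = i` for `τ = (1 + i)/2`; it transports the values of `E₄` and `E₆` at `i` to
the line `Re τ = 1/2`. -/
theorem vadd_S_smul_verticalPoint_half :
    (1 : ℝ) +ᵥ (ModularGroup.S • verticalPoint (1 / 2) (-Real.log 2)) = verticalPoint 0 0 := by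
  rw [modular_S_smul]
  apply UpperHalfPlane.ext
  rw [coe_vadd]
  simp only [coe_verticalPoint_half, coe_verticalPoint_zero_zero]
  have h : (1 + Complex.I) ≠ 0 := fun h => by simpa using congrArg Complex.re h
  have h2 := Complex.I_mul_I
  rw [inv_neg, inv_div]
  field_simp
  push_cast
  linear_combination -h2

/-- The point `i` is fixed by `S`, so weight `6` gives `E₆(i) = i⁶E₆(i) = -E₆(i)`. -/
theorem E₆_verticalPoint_zero : E₆ (verticalPoint 0 0) = 0 := by
  have := eisensteinSeries_S_smul (k := 6) (by norm_num) (verticalPoint 0 0)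
  rw [S_smul_verticalPoint_zero_zero, coe_verticalPoint_zero_zero,
    show Complex.I ^ 6 = -1 by rw [show 6 = 2 * 3 from rfl, pow_mul, Complex.I_sq]; norm_num] at this
  linear_combination this / 2

theorem eisensteinSeries_verticalPoint_half {k : ℕ} (hk : 3 ≤ k) :
    E hk (verticalPoint 0 0) =
      ((1 + Complex.I) / 2) ^ k * E hk (verticalPoint (1 / 2) (-Real.log 2)) := by
  rw [← coe_verticalPoint_half, ← eisensteinSeries_S_smul, ← eisensteinSeries_vadd hk (_ • _),
    vadd_S_smul_verticalPoint_half]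

theorem E₄_verticalPoint_half :
    E₄ (verticalPoint (1 / 2) (-Real.log 2)) = -4 * E₄ (verticalPoint 0 0) := by
  have h := eisensteinSeries_verticalPoint_half (k := 4) (by norm_num)
  rw [show ((1 + Complex.I) / 2) ^ 4 = -1 / 4 by
    linear_combination (Complex.I_sq * (Complex.I ^ 2 + 4 * Complex.I + 5)) / 16] at h
  rw [h]
  ring

theorem E₆_verticalPoint_half : E₆ (verticalPoint (1 / 2) (-Real.log 2)) = 0 := by
  have h := eisensteinSeries_verticalPoint_half (k := 6) (by norm_num)
  have h0 : (1 + Complex.I) / 2 ≠ 0 := fun h => by simpa using congrArg Complex.re h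
  rw [E₆_verticalPoint_zero, eq_comm, mul_eq_zero] at h
  exact h.resolve_left (pow_ne_zero _ h0)

/-- At `τ = i` the nome `q` is positive, and every coefficient of `E₄ = 1 + 240 Σ σ₃(n)qⁿ` is
positive. -/
theorem re_E₄_verticalPoint_pos : 0 < (E₄ (verticalPoint 0 0)).re := by
  rw [eisensteinSeries_eq_ofReal _ ⟨2, rfl⟩ _ (exp_verticalPoint_zero 0), Complex.ofReal_re]
  have : 0 ≤ ∑' n : ℕ+, (ArithmeticFunction.sigma (4 - 1) n : ℝ) *
    (Real.exp (-(2 * Real.pi * Real.exp 0))) ^ (n : ℕ) := tsum_nonneg fun n => by positivity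
  rw [show bernoulli 4 = -1 / 30 by decide +kernel]
  push_cast
  linarith

theorem exists_real_eisensteinSeries_verticalPoint {k : ℕ} (hk : 3 ≤ k) (hk2 : Even k) {x : ℝ}
    (hx : x = 0 ∨ x = 1 / 2) (t : ℝ) : ∃ y : ℝ, E hk (verticalPoint x t) = y := by
  rcases hx with rfl | rfl
  · exact ⟨_, eisensteinSeries_eq_ofReal hk hk2 _ (exp_verticalPoint_zero t)⟩
  · exact ⟨_, eisensteinSeries_eq_ofReal hk hk2 _ (exp_verticalPoint_half t)⟩

/-- Intermediate values of `E₆² - rE₄³` on a vertical line where `q`, hence `E₄` and `E₆`, is real.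
At `i∞` its value is `1 - r`. At `i` it is `-rE₄(i)³ ≤ 0`, which serves `r < 1`; at `(1 + i)/2`,
where `E₄ = -4E₄(i)`, it is `≥ 0`, which serves `r > 1`. -/
theorem exists_E₆_sq_eq_mul_E₄_cube {r : ℝ} (hr0 : 0 ≤ r) (hr : r ≠ 1) :
    ∃ τ : ℍ, E₆ τ ^ 2 = r * E₄ τ ^ 3 := by
  -- The factor `1 - r` makes the limit at `i∞` positive in both cases, so that one argument covers
  -- both lines.
  have key : ∀ x : ℝ, (x = 0 ∨ x = 1 / 2) → (∃ t, (E₆ (verticalPoint x t) ^ 2 -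
      r * E₄ (verticalPoint x t) ^ 3).re * (1 - r) ≤ 0) → ∃ τ : ℍ, E₆ τ ^ 2 = r * E₄ τ ^ 3 := by
    rintro x hx ⟨t₀, ht₀⟩
    have hcont : Continuous fun t => (E₆ (verticalPoint x t) ^ 2 -
        r * E₄ (verticalPoint x t) ^ 3).re * (1 - r) := by
      have h4 := (ModularFormClass.continuous E₄).comp (continuous_verticalPoint x)
      have h6 := (ModularFormClass.continuous E₆).comp (continuous_verticalPoint x)
      exact (Complex.continuous_re.comp
        ((h6.pow 2).sub ((continuous_const (y := (r : ℂ))).mul (h4.pow 3)))).mul_const _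
    have hlim : Tendsto (fun t => (E₆ (verticalPoint x t) ^ 2 -
        r * E₄ (verticalPoint x t) ^ 3).re * (1 - r)) atTop (𝓝 ((1 - r) * (1 - r))) := by
      have h4 := (tendsto_eisensteinSeries_atImInfty (k := 4) (by norm_num) ⟨2, rfl⟩).comp
        (tendsto_verticalPoint_atImInfty x)
      have h6 := (tendsto_eisensteinSeries_atImInfty (k := 6) (by norm_num) ⟨3, rfl⟩).comp
        (tendsto_verticalPoint_atImInfty x)
      have := (Complex.continuous_re.tendsto _).comp ((h6.pow 2).sub ((h4.pow 3).const_mul (r : ℂ)))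
      simpa using this.mul_const (1 - r)
    have hpos : 0 < (1 - r) * (1 - r) := mul_self_pos.mpr (sub_ne_zero.mpr hr.symm)
    obtain ⟨t₁, ht₁⟩ := (hlim.eventually (lt_mem_nhds hpos)).exists
    obtain ⟨t, ht⟩ := mem_range_of_exists_le_of_exists_ge hcont ⟨t₀, ht₀⟩ ⟨t₁, ht₁.le⟩
    refine ⟨verticalPoint x t, ?_⟩
    obtain ⟨a, ha⟩ := exists_real_eisensteinSeries_verticalPoint (k := 4) (by norm_num)
      ⟨2, rfl⟩ hx t
    obtain ⟨b, hb⟩ := exists_real_eisensteinSeries_verticalPoint (k := 6) (by norm_num)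
      ⟨3, rfl⟩ hx t
    have h0 := (mul_eq_zero.mp ht).resolve_right (sub_ne_zero.mpr hr.symm)
    rw [ha, hb] at h0 ⊢
    norm_cast at h0 ⊢
    linarith
  have hE := re_E₄_verticalPoint_pos
  obtain ⟨a, ha⟩ := exists_real_eisensteinSeries_verticalPoint (k := 4) (by norm_num)
    ⟨2, rfl⟩ (x := 0) (by simp) 0
  rw [ha, Complex.ofReal_re] at hE
  rcases lt_or_gt_of_ne hr with h | h
  · refine key 0 (by simp) ⟨0, ?_⟩
    rw [E₆_verticalPoint_zero, ha]
    norm_cast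
    have := mul_nonneg (mul_nonneg hr0 (pow_pos hE 3).le) (sub_pos.mpr h).le
    push_cast
    linarith
  · refine key (1 / 2) (by simp) ⟨-Real.log 2, ?_⟩
    rw [E₆_verticalPoint_half, E₄_verticalPoint_half, ha]
    norm_cast
    have := mul_nonneg (mul_nonneg hr0 (pow_pos hE 3).le) (sub_pos.mpr h).le
    push_cast
    linarith

/-- The periods `c τ` and `c`. -/
def _root_.PeriodPair.ofUpperHalfPlane (c : ℂ) (hc : c ≠ 0) (τ : ℍ) : PeriodPair where
  ω₁ := c * τ
  ω₂ := c
  indep := by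
    rw [LinearIndependent.pair_iff]
    intro s t h
    have h1 : (s * τ + t : ℂ) = 0 := by
      apply (mul_eq_zero.mp (?_ : c * (s * τ + t : ℂ) = 0)).resolve_left hc
      simp only [Complex.real_smul] at h
      linear_combination h
    have him := congrArg Complex.im h1
    have hre := congrArg Complex.re h1
    have hτ : (τ : ℂ).im ≠ 0 := τ.im_ne_zero
    simp only [Complex.add_im, Complex.im_ofReal_mul, Complex.ofReal_im, add_zero,
      Complex.zero_im, mul_eq_zero, hτ, or_false] at him
    simpa [him] using hre

theorem G_ofUpperHalfPlane {c : ℂ} (hc : c ≠ 0) (τ : ℍ) {k : ℕ} (hk : 3 ≤ k) (hk2 : Even k) :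
    (PeriodPair.ofUpperHalfPlane c hc τ).G k = 2 * riemannZeta k * E hk τ / c ^ k := by
  have hζ : riemannZeta k ≠ 0 :=
    riemannZeta_ne_zero_of_one_lt_re (by rw [Complex.natCast_re]; exact_mod_cast by omega)
  have h1 := tsum_eisSummand_eq_tsum_sigma_mul_cexp_pow hk hk2 τ
  have h2 := q_expansion_riemannZeta hk hk2 τ
  have h3 : ∑' v, eisSummand k v τ = 2 * riemannZeta k * E hk τ := by
    rw [h1, h2]
    simp only [zpow_natCast]
    field_simp
  rw [← h3, ← (finTwoArrowEquiv ℤ).symm.tsum_eq, PeriodPair.G,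
    ← (PeriodPair.ofUpperHalfPlane c hc τ).latticeEquivProd.symm.toEquiv.tsum_eq, ← tsum_div_const]
  congr 1
  ext x
  have : ((PeriodPair.ofUpperHalfPlane c hc τ).latticeEquivProd.symm.toEquiv x : ℂ) =
      c * (x.1 * τ + x.2) := by
    refine ((PeriodPair.ofUpperHalfPlane c hc τ).latticeEquiv_symm_apply x).trans ?_
    simp only [PeriodPair.ofUpperHalfPlane]
    ring
  rw [this, mul_pow]
  simp [eisSummand, div_eq_mul_inv, mul_comm]

theorem g₂_ofUpperHalfPlane {c : ℂ} (hc : c ≠ 0) (τ : ℍ) :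
    (PeriodPair.ofUpperHalfPlane c hc τ).g₂ = 4 * Real.pi ^ 4 / 3 * E₄ τ / c ^ 4 := by
  have h := G_ofUpperHalfPlane hc τ (k := 4) (by norm_num) ⟨2, rfl⟩
  rw [PeriodPair.g₂, h, Nat.cast_ofNat, riemannZeta_four]
  ring

theorem g₃_ofUpperHalfPlane {c : ℂ} (hc : c ≠ 0) (τ : ℍ) :
    (PeriodPair.ofUpperHalfPlane c hc τ).g₃ = 8 * Real.pi ^ 6 / 27 * E₆ τ / c ^ 6 := by
  have hζ := riemannZeta_two_mul_nat (k := 3) (by norm_num)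
  norm_num [show bernoulli 6 = 1 / 42 by decide +kernel, Nat.factorial] at hζ
  have h := G_ofUpperHalfPlane hc τ (k := 6) (by norm_num) ⟨3, rfl⟩
  rw [PeriodPair.g₃, h, Nat.cast_ofNat, hζ]
  ring

/-- Every nonsingular cubic `y² = 4x³ - (4/3)x - γ` with real `γ` is uniformized by a lattice. -/
theorem exists_periodPair_g₂_eq_g₃_eq (γ : ℝ) (hγ : 729 * γ ^ 2 ≠ 64) :
    ∃ L : PeriodPair, L.g₂ = 4 / 3 ∧ L.g₃ = γ := by
  obtain ⟨τ, hτ⟩ := exists_E₆_sq_eq_mul_E₄_cube (r := 729 * γ ^ 2 / 64) (by positivity)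
    (by intro h; apply hγ; linarith)
  have h4 : E₄ τ ≠ 0 := by
    intro h4
    have h6 : E₆ τ = 0 := by simpa [h4] using hτ
    have := discriminant_ne_zero τ
    have h := discriminant_eq_E₄_cube_sub_E₆_sq τ
    rw [h4, h6] at h
    norm_num at h
    exact this h
  have hπ : (Real.pi : ℂ) ≠ 0 := by exact_mod_cast Real.pi_ne_zero
  -- The scale that turns `g₂ = (4π⁴/3)E₄/c⁴` into `4/3`. It fixes `g₃` only up to sign; replacing
  -- `c` by `ic` keeps `g₂` and negates `g₃`.
  obtain ⟨c, hc⟩ := IsAlgClosed.exists_pow_nat_eq (Real.pi ^ 4 * E₄ τ : ℂ) (n := 4) (by norm_num)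
  have hc0 : c ≠ 0 := by
    rintro rfl
    exact mul_ne_zero (pow_ne_zero 4 hπ) h4 (by simpa using hc.symm)
  have hsq : (8 * Real.pi ^ 6 / 27 * E₆ τ / c ^ 6) ^ 2 = (γ : ℂ) ^ 2 := by
    rw [div_pow, show (c ^ 6) ^ 2 = (c ^ 4) ^ 3 by ring, hc, mul_pow, hτ]
    push_cast
    field_simp
    ring
  have h2 : ∀ a : ℂ, a ^ 4 = c ^ 4 → ∀ ha : a ≠ 0,
      (PeriodPair.ofUpperHalfPlane a ha τ).g₂ = 4 / 3 := by
    intro a hac ha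
    rw [g₂_ofUpperHalfPlane, hac, hc]
    field_simp
  rcases sq_eq_sq_iff_eq_or_eq_neg.mp hsq with h | h
  · exact ⟨_, h2 c rfl hc0, by rw [g₃_ofUpperHalfPlane, h]⟩
  · refine ⟨_, h2 (Complex.I * c) (by rw [mul_pow, Complex.I_pow_four, one_mul])
      (mul_ne_zero Complex.I_ne_zero hc0), ?_⟩
    rw [g₃_ofUpperHalfPlane, mul_pow,
      show Complex.I ^ 6 = -1 by rw [show 6 = 2 * 3 from rfl, pow_mul, Complex.I_sq]; norm_num,
      neg_one_mul, div_neg, h, neg_neg]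

end EisensteinSeries

/-! ### Principal parts of order at most two, their residues and pole orders. -/

/-- Near `a`, the function `f` is `α / (z - a)² + β / (z - a)` up to an analytic function. -/
def HasPrincipalPart (f : ℂ → ℂ) (a α β : ℂ) : Prop :=
  ∃ φ : ℂ → ℂ, AnalyticAt ℂ φ a ∧
    ∀ᶠ z in 𝓝[≠] a, f z = α / (z - a) ^ 2 + β / (z - a) + φ z

theorem AnalyticAt.dslope {m : ℂ → ℂ} {a : ℂ} (hm : AnalyticAt ℂ m a) :
    AnalyticAt ℂ (dslope m a) a := by
  obtain ⟨p, hp⟩ := hm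
  exact ⟨_, hp.has_fpower_series_dslope_fslope⟩

theorem eq_add_mul_dslope (m : ℂ → ℂ) (a z : ℂ) : m z = m a + (z - a) * dslope m a z := by
  have := sub_smul_dslope m a z
  rw [smul_eq_mul] at this
  rw [this]
  ring

/-- Write `m = m(a) + (z - a)k`. Then `m' = k + (z - a)k'`, and differentiating again at `a` gives
`m''(a) = 2k'(a)`. This second Taylor coefficient enters the residue at the double pole. -/
theorem deriv_dslope_same {m : ℂ → ℂ} {a : ℂ} {m' : ℂ → ℂ} {m₂ : ℂ} (hm : AnalyticAt ℂ m a)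
    (hm' : ∀ᶠ z in 𝓝 a, HasDerivAt m (m' z) z) (hm₂ : HasDerivAt m' m₂ a) :
    HasDerivAt (dslope m a) (m₂ / 2) a := by
  have hk := hm.dslope
  have h1 : m' =ᶠ[𝓝 a] fun z => dslope m a z + (z - a) * deriv (dslope m a) z := by
    filter_upwards [hm', hk.eventually_analyticAt] with z hz hkz
    have h2 := (((hasDerivAt_id z).sub_const a).mul hkz.differentiableAt.hasDerivAt).const_add (m a)
    have h3 : m = fun z => m a + (id z - a) * dslope m a z := by
      ext z
      exact eq_add_mul_dslope m a z
    rw [h3] at hz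
    have := hz.unique (h2.congr_of_eventuallyEq (by
      filter_upwards with w
      simp))
    rw [this]
    simp
  have hkd := hk.differentiableAt.hasDerivAt
  have h2 := hkd.add (((hasDerivAt_id a).sub_const a).mul hk.deriv.differentiableAt.hasDerivAt)
  have h3 := hm₂.unique (h2.congr_of_eventuallyEq h1)
  convert! hkd using 1
  simp only [id, sub_self, zero_mul, add_zero, one_mul] at h3
  rw [h3]
  ring

theorem hasPrincipalPart_of_eq_div {f m : ℂ → ℂ} {a : ℂ} (hm : AnalyticAt ℂ m a)
    (h : ∀ᶠ z in 𝓝[≠] a, f z = m z / (z - a)) : HasPrincipalPart f a 0 (m a) := by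
  refine ⟨dslope m a, hm.dslope, ?_⟩
  filter_upwards [h, self_mem_nhdsWithin] with z hz hza
  have : z - a ≠ 0 := sub_ne_zero.mpr hza
  rw [hz, eq_add_mul_dslope m a z]
  field_simp
  ring

theorem hasPrincipalPart_of_eq_div_sq {f m : ℂ → ℂ} {a β : ℂ} (hm : AnalyticAt ℂ m a)
    (hβ : HasDerivAt m β a) (h : ∀ᶠ z in 𝓝[≠] a, f z = m z / (z - a) ^ 2) :
    HasPrincipalPart f a (m a) β := by
  refine ⟨dslope (dslope m a) a, hm.dslope.dslope, ?_⟩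
  filter_upwards [h, self_mem_nhdsWithin] with z hz hza
  have : z - a ≠ 0 := sub_ne_zero.mpr hza
  rw [hz, eq_add_mul_dslope m a z, eq_add_mul_dslope (dslope m a) a z, dslope_same, hβ.deriv]
  field_simp
  ring

namespace HasPrincipalPart

variable {f : ℂ → ℂ} {a α β : ℂ}

theorem const_mul (h : HasPrincipalPart f a α β) (k : ℂ) :
    HasPrincipalPart (fun z => k * f z) a (k * α) (k * β) := by
  obtain ⟨φ, hφ, h⟩ := h
  refine ⟨fun z => k * φ z, analyticAt_const.mul hφ, ?_⟩
  filter_upwards [h] with z hz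
  rw [hz]
  ring

theorem comp_sub (h : HasPrincipalPart f a α β) (b : ℂ) :
    HasPrincipalPart (fun z => f (z - b)) (a + b) α β := by
  obtain ⟨φ, hφ, h⟩ := h
  refine ⟨fun z => φ (z - b), ?_, ?_⟩
  · exact AnalyticAt.fun_comp (f := fun z => z - b) (by simpa using hφ) (by fun_prop)
  · have hT : Tendsto (fun z => z - b) (𝓝[≠] (a + b)) (𝓝[≠] a) := by
      refine tendsto_nhdsWithin_iff.mpr ⟨?_, ?_⟩
      · exact ((continuous_sub_right b).tendsto' _ _ (by simp)).mono_left nhdsWithin_le_nhds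
      · filter_upwards [self_mem_nhdsWithin] with t ht
        simpa [sub_eq_iff_eq_add] using ht
    filter_upwards [hT.eventually h] with z hz
    rw [hz, sub_sub, add_comm b a]

theorem hasResidue (h : HasPrincipalPart f a α β) : Schwarzschild.HasResidue f a β := by
  obtain ⟨φ, hφ, h⟩ := h
  obtain ⟨r, hr, hball⟩ := Metric.eventually_nhds_iff_ball.mp
    (hφ.eventually_analyticAt.and (eventually_nhdsWithin_iff.mp h))
  filter_upwards [Ioo_mem_nhdsGT hr] with R ⟨hR0, hRr⟩
  have hsub : Metric.closedBall a R ⊆ Metric.ball a r := Metric.closedBall_subset_ball hRr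
  have hφd : ∀ z ∈ Metric.closedBall a R, DifferentiableAt ℂ φ z := fun z hz =>
    (hball z (hsub hz)).1.differentiableAt
  have hφc : ContinuousOn φ (Metric.closedBall a R) := fun z hz =>
    (hφd z hz).continuousAt.continuousWithinAt
  have hne : ∀ z ∈ Metric.sphere a R, z - a ≠ 0 := fun z hz h0 => by
    rw [mem_sphere_iff_norm, h0, norm_zero] at hz
    exact hR0.ne hz
  have h1 : ContinuousOn (fun z => α * (z - a) ^ (-2 : ℤ)) (Metric.sphere a R) :=
    continuousOn_const.mul ((continuousOn_id.sub continuousOn_const).zpow₀ _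
      fun z hz => Or.inl (hne z hz))
  have h2 : ContinuousOn (fun z => β * (z - a)⁻¹) (Metric.sphere a R) :=
    continuousOn_const.mul ((continuousOn_id.sub continuousOn_const).inv₀ hne)
  have hφs := hφc.mono Metric.sphere_subset_closedBall
  have heq : EqOn f (fun z => (α * (z - a) ^ (-2 : ℤ) + β * (z - a)⁻¹) + φ z)
      (Metric.sphere a R) := by
    intro z hz
    have hz' := hne z hz
    rw [(hball z (hsub (Metric.sphere_subset_closedBall hz))).2 (sub_ne_zero.mp hz')]
    simp [zpow_neg, div_eq_mul_inv, zpow_ofNat]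
  rw [circleIntegral.integral_congr hR0.le heq,
    circleIntegral.integral_add ((h1.fun_add h2).circleIntegrable hR0.le) (hφs.circleIntegrable hR0.le),
    circleIntegral.integral_add (h1.circleIntegrable hR0.le) (h2.circleIntegrable hR0.le),
    circleIntegral.integral_const_mul, circleIntegral.integral_const_mul,
    circleIntegral.integral_sub_zpow_of_ne (by norm_num),
    circleIntegral.integral_sub_inv_of_mem_ball (Metric.mem_ball_self hR0),
    Complex.circleIntegral_eq_zero_of_differentiable_on_off_countable hR0.le countable_empty hφc
      (fun z hz => hφd z (Metric.ball_subset_closedBall hz.1))]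
  ring

theorem meromorphicAt (h : HasPrincipalPart f a α β) : MeromorphicAt f a := by
  obtain ⟨φ, hφ, h⟩ := h
  have : MeromorphicAt (fun z => α / (z - a) ^ 2 + β / (z - a) + φ z) a := by
    have := hφ.meromorphicAt
    fun_prop
  exact this.congr (h.mono fun z hz => hz.symm)

theorem meromorphicOrderAt_double (h : HasPrincipalPart f a α β) (hα : α ≠ 0) :
    meromorphicOrderAt f a = (-2 : ℤ) := by
  refine (meromorphicOrderAt_eq_int_iff h.meromorphicAt).mpr ?_
  obtain ⟨φ, hφ, h⟩ := h
  refine ⟨fun z => α + β * (z - a) + (z - a) ^ 2 * φ z, by fun_prop, by simpa using hα, ?_⟩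
  filter_upwards [h, self_mem_nhdsWithin] with z hz hza
  have : z - a ≠ 0 := sub_ne_zero.mpr hza
  rw [hz, zpow_neg, zpow_ofNat, smul_eq_mul]
  field_simp

theorem meromorphicOrderAt_simple (h : HasPrincipalPart f a 0 β) (hβ : β ≠ 0) :
    meromorphicOrderAt f a = (-1 : ℤ) := by
  refine (meromorphicOrderAt_eq_int_iff h.meromorphicAt).mpr ?_
  obtain ⟨φ, hφ, h⟩ := h
  refine ⟨fun z => β + (z - a) * φ z, by fun_prop, by simpa using hβ, ?_⟩
  filter_upwards [h, self_mem_nhdsWithin] with z hz hza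
  have : z - a ≠ 0 := sub_ne_zero.mpr hza
  rw [hz, zpow_neg, zpow_one, smul_eq_mul]
  field_simp
  ring

end HasPrincipalPart

/-! ### The function `4/(℘' + c)` and its expansions at the poles. -/

namespace PeriodPair

variable (L : PeriodPair)

open Classical in
/-- The function `4 / (℘' + c)`, with its zeros at the lattice points filled in. -/
def fourDivDeriv (c z : ℂ) : ℂ := if z ∈ L.lattice then 0 else 4 / (L.derivWeierstrassP z + c)

variable {L} {c : ℂ}

theorem add_mem_lattice_iff {l : ℂ} (hl : l ∈ L.lattice) (z : ℂ) :
    z + l ∈ L.lattice ↔ z ∈ L.lattice :=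
  L.lattice.toAddSubgroup.add_mem_cancel_right hl

theorem fourDivDeriv_add {l : ℂ} (hl : l ∈ L.lattice) (z : ℂ) :
    L.fourDivDeriv c (z + l) = L.fourDivDeriv c z := by
  have := L.derivWeierstrassP_add_coe z ⟨l, hl⟩
  by_cases hz : z ∈ L.lattice <;> simp_all [fourDivDeriv, add_mem_lattice_iff hl]

theorem fourDivDeriv_of_notMem {z : ℂ} (hz : z ∉ L.lattice) :
    L.fourDivDeriv c z = 4 / (L.derivWeierstrassP z + c) := if_neg hz

theorem analyticAt_fourDivDeriv_of_notMem {z : ℂ} (hz : z ∉ L.lattice)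
    (h : L.derivWeierstrassP z + c ≠ 0) : AnalyticAt ℂ (L.fourDivDeriv c) z := by
  have h1 : AnalyticAt ℂ (fun w => 4 / (L.derivWeierstrassP w + c)) z :=
    analyticAt_const.div ((L.analyticOnNhd_derivWeierstrassP z hz).add analyticAt_const) h
  refine h1.congr ?_
  filter_upwards [L.eventually_notMem_lattice hz] with w hw
  exact (fourDivDeriv_of_notMem hw).symm

/-- Since `℘'` is `-2/(z - l)³` plus an analytic function, clearing the cube leaves a denominator
with value `-2` at `l`. -/
theorem analyticAt_fourDivDeriv_of_mem {l : ℂ} (hl : l ∈ L.lattice) :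
    AnalyticAt ℂ (L.fourDivDeriv c) l := by
  have h0 := L.analyticAt_derivWeierstrassPExcept l
  have h1 : AnalyticAt ℂ (fun z => 4 * (z - l) ^ 3 /
      ((L.derivWeierstrassPExcept l z + c) * (z - l) ^ 3 - 2)) l := by
    refine AnalyticAt.div (by fun_prop) (by fun_prop) (by simp)
  refine h1.congr ?_
  filter_upwards [eventually_nhdsWithin_iff.mp (L.eventually_notMem_lattice_nhdsNE l)] with z hz
  by_cases hzl : z = l
  · simp [hzl, fourDivDeriv, hl]
  · have h3 := L.derivWeierstrassPExcept_def ⟨l, hl⟩ z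
    have h4 : z - l ≠ 0 := sub_ne_zero.mpr hzl
    rw [fourDivDeriv_of_notMem (hz hzl), h3]
    have h5 : (L.derivWeierstrassP z + 2 / (z - l) ^ 3 + c) * (z - l) ^ 3 - 2 =
        (L.derivWeierstrassP z + c) * (z - l) ^ 3 := by
      field_simp
      ring
    rw [h5, mul_div_mul_right _ _ (pow_ne_zero 3 h4)]

theorem derivWeierstrassP_sq_sub (hg₂ : L.g₂ = 4 / 3) (hg₃ : L.g₃ = 8 / 27 - c ^ 2) {z : ℂ}
    (hz : z ∉ L.lattice) :
    27 * ((L.derivWeierstrassP z + c) * (L.derivWeierstrassP z - c)) =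
      4 * ((3 * L.weierstrassP z - 2) * (3 * L.weierstrassP z + 1) ^ 2) := by
  have := L.derivWeierstrassP_sq z hz
  rw [hg₂, hg₃] at this
  linear_combination 27 * this

theorem weierstrassP_eq_of_derivWeierstrassP_eq (hg₂ : L.g₂ = 4 / 3)
    (hg₃ : L.g₃ = 8 / 27 - c ^ 2) {z : ℂ} (hz : z ∉ L.lattice)
    (h : L.derivWeierstrassP z = -c) :
    L.weierstrassP z = 2 / 3 ∨ L.weierstrassP z = -1 / 3 := by
  have h1 := derivWeierstrassP_sq_sub hg₂ hg₃ hz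
  rw [h, neg_add_cancel, zero_mul, mul_zero, eq_comm] at h1
  rcases mul_eq_zero.mp ((mul_eq_zero.mp h1).resolve_left (by norm_num)) with h1 | h1
  · left; linear_combination h1 / 3
  · right; linear_combination (pow_eq_zero_iff two_ne_zero).mp h1 / 3

theorem hasPrincipalPart_fourDivDeriv_simple (hg₂ : L.g₂ = 4 / 3)
    (hg₃ : L.g₃ = 8 / 27 - c ^ 2) (hc : c ≠ 0) {a : ℂ} (ha : a ∉ L.lattice)
    (h : L.weierstrassP a = 2 / 3) (h' : L.derivWeierstrassP a = -c) :
    HasPrincipalPart (L.fourDivDeriv c) a 0 2 := by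
  have hp := L.analyticOnNhd_weierstrassP a ha
  have hp' := L.analyticOnNhd_derivWeierstrassP a ha
  have hk := hp.dslope
  have hka : dslope L.weierstrassP a a = -c := by
    rw [dslope_same, (L.hasDerivAt_weierstrassP ha).deriv, h']
  -- The factorization rewrites `4/(℘' + c)` as `27(℘' - c)/((3℘ - 2)(3℘ + 1)²)`, with `3℘ - 2 = 3(z
  -- - a)·dslope`; here `m` is what remains after removing `1/(z - a)`.
  set m : ℂ → ℂ := fun z => 9 * (L.derivWeierstrassP z - c) /
    (dslope L.weierstrassP a z * (3 * L.weierstrassP z + 1) ^ 2) with hm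
  have hden : dslope L.weierstrassP a a * (3 * L.weierstrassP a + 1) ^ 2 ≠ 0 := by
    rw [hka, h]
    norm_num [hc]
  have hman : AnalyticAt ℂ m a := AnalyticAt.div (by fun_prop) (by fun_prop) hden
  have hma : m a = 2 := by
    simp only [hm, hka, h, h']
    field_simp
    norm_num
  rw [← hma]
  refine hasPrincipalPart_of_eq_div hman ?_
  have hne : ∀ᶠ z in 𝓝 a, dslope L.weierstrassP a z * (3 * L.weierstrassP z + 1) ^ 2 ≠ 0 :=
    ContinuousAt.eventually_ne (by fun_prop) hden
  have hne2 : ∀ᶠ z in 𝓝 a, L.derivWeierstrassP z - c ≠ 0 :=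
    ContinuousAt.eventually_ne (by fun_prop) (by
      rw [h', ← neg_add', ← two_mul, neg_ne_zero]
      exact mul_ne_zero two_ne_zero hc)
  filter_upwards [mem_nhdsWithin_of_mem_nhds hne, mem_nhdsWithin_of_mem_nhds hne2,
    mem_nhdsWithin_of_mem_nhds (L.eventually_notMem_lattice ha), self_mem_nhdsWithin]
    with z hz hz2 hzL hza
  have hza' : z - a ≠ 0 := sub_ne_zero.mpr hza
  have h1 := derivWeierstrassP_sq_sub hg₂ hg₃ hzL
  have h2 := eq_add_mul_dslope L.weierstrassP a z
  rw [h] at h2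
  have h3 : 9 * (L.derivWeierstrassP z + c) * (L.derivWeierstrassP z - c) =
      4 * (z - a) * (dslope L.weierstrassP a z * (3 * L.weierstrassP z + 1) ^ 2) := by
    linear_combination h1 / 3 + 4 * (3 * L.weierstrassP z + 1) ^ 2 * h2
  have h4 : L.derivWeierstrassP z + c ≠ 0 := by
    intro h4
    rw [h4, mul_zero, zero_mul, eq_comm] at h3
    exact mul_ne_zero (mul_ne_zero (by norm_num) hza') hz h3
  rw [fourDivDeriv_of_notMem hzL, div_div, div_eq_div_iff h4 (mul_ne_zero hz hza')]
  linear_combination -h3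

theorem hasPrincipalPart_fourDivDeriv_double (hg₂ : L.g₂ = 4 / 3)
    (hg₃ : L.g₃ = 8 / 27 - c ^ 2) (hc : c ≠ 0) {a : ℂ} (ha : a ∉ L.lattice)
    (h : L.weierstrassP a = -1 / 3) (h' : L.derivWeierstrassP a = -c) :
    HasPrincipalPart (L.fourDivDeriv c) a (2 / c) (-2) := by
  have hp := L.analyticOnNhd_weierstrassP a ha
  have hp' := L.analyticOnNhd_derivWeierstrassP a ha
  have hk := hp.dslope
  have hka : dslope L.weierstrassP a a = -c := by
    rw [dslope_same, (L.hasDerivAt_weierstrassP ha).deriv, h']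
  -- The value `℘ = -1/3` is a critical point of the cubic, so `℘''` vanishes. Consequently only the
  -- factor `3℘ - 2` contributes to the derivative of `m` at `a`, which is the residue.
  have h2a : HasDerivAt L.derivWeierstrassP 0 a := by
    convert! L.hasDerivAt_derivWeierstrassP ha using 1
    rw [h, hg₂]
    norm_num
  have hkd : HasDerivAt (dslope L.weierstrassP a) 0 a := by
    simpa using deriv_dslope_same hp ((L.eventually_notMem_lattice ha).mono
      fun z hz => L.hasDerivAt_weierstrassP hz) h2a
  set m : ℂ → ℂ := fun z => 3 * (L.derivWeierstrassP z - c) /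
    (dslope L.weierstrassP a z ^ 2 * (3 * L.weierstrassP z - 2)) with hm
  have hden : dslope L.weierstrassP a a ^ 2 * (3 * L.weierstrassP a - 2) ≠ 0 := by
    rw [hka, h]
    norm_num [hc]
  have hman : AnalyticAt ℂ m a := AnalyticAt.div (by fun_prop) (by fun_prop) hden
  have hma : m a = 2 / c := by
    simp only [hm, hka, h, h']
    field_simp
    norm_num
  have hmd : HasDerivAt m (-2) a := by
    have h1 := ((h2a.sub_const c).const_mul 3).div
      ((hkd.pow 2).mul (((L.hasDerivAt_weierstrassP ha).const_mul 3).sub_const 2)) hden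
    convert! h1 using 1
    simp only [hka, h, h', Pi.pow_apply, Pi.mul_apply]
    field_simp
    norm_num
    ring
  rw [← hma]
  refine hasPrincipalPart_of_eq_div_sq hman hmd ?_
  have hne : ∀ᶠ z in 𝓝 a, dslope L.weierstrassP a z ^ 2 * (3 * L.weierstrassP z - 2) ≠ 0 :=
    ContinuousAt.eventually_ne (by fun_prop) hden
  have hne2 : ∀ᶠ z in 𝓝 a, L.derivWeierstrassP z - c ≠ 0 :=
    ContinuousAt.eventually_ne (by fun_prop) (by
      rw [h', ← neg_add', ← two_mul, neg_ne_zero]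
      exact mul_ne_zero two_ne_zero hc)
  filter_upwards [mem_nhdsWithin_of_mem_nhds hne, mem_nhdsWithin_of_mem_nhds hne2,
    mem_nhdsWithin_of_mem_nhds (L.eventually_notMem_lattice ha), self_mem_nhdsWithin]
    with z hz hz2 hzL hza
  have hza' : z - a ≠ 0 := sub_ne_zero.mpr hza
  have h1 := derivWeierstrassP_sq_sub hg₂ hg₃ hzL
  have h2 : 3 * L.weierstrassP z + 1 = 3 * ((z - a) * dslope L.weierstrassP a z) := by
    have h2 := eq_add_mul_dslope L.weierstrassP a z
    rw [h] at h2
    linear_combination 3 * h2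
  rw [h2] at h1
  have h3 : 3 * (L.derivWeierstrassP z + c) * (L.derivWeierstrassP z - c) =
      4 * (z - a) ^ 2 * (dslope L.weierstrassP a z ^ 2 * (3 * L.weierstrassP z - 2)) := by
    linear_combination h1 / 9
  have h4 : L.derivWeierstrassP z + c ≠ 0 := by
    intro h4
    rw [h4, mul_zero, zero_mul, eq_comm] at h3
    exact mul_ne_zero (mul_ne_zero (by norm_num) (pow_ne_zero 2 hza')) hz h3
  rw [fourDivDeriv_of_notMem hzL, div_div,
    div_eq_div_iff h4 (mul_ne_zero hz (pow_ne_zero 2 hza'))]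
  linear_combination -h3

end PeriodPair

/-! ### Single-valued solutions of `P' = fP` when the residues of `f` are integers. -/

theorem isPreconnected_ball_diff_countable (c : ℂ) (r : ℝ) {s : Set ℂ} (hs : s.Countable) :
    IsPreconnected (Metric.ball c r \ s) := by
  rcases le_or_gt r 0 with hr | hr
  · simp [Metric.ball_eq_empty.mpr hr, isPreconnected_empty]
  -- Identifying the ball with the whole plane reduces the claim to connectedness of the complement
  -- of a countable set in `ℂ`.
  set e := OpenPartialHomeomorph.univBall c r with he
  have hsrc : e.source = univ := OpenPartialHomeomorph.univBall_source c r
  have htgt : e.target = Metric.ball c r := OpenPartialHomeomorph.univBall_target c hr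
  have hinj : Function.Injective e := by
    rw [← injOn_univ, ← hsrc]
    exact e.injOn
  have himg : e '' (e ⁻¹' s)ᶜ = Metric.ball c r \ s := by
    rw [← htgt, ← e.image_source_eq_target, hsrc, ← preimage_compl, image_preimage_eq_inter_range,
      image_univ, inter_comm, sdiff_eq]
  rw [← himg]
  exact (PeriodPair.isPreconnected_compl_of_countable (hs.preimage hinj)).image _
    (OpenPartialHomeomorph.continuous_univBall c r).continuousOn

/-- A function with prescribed principal parts at finitely many points agrees away from them with
the sum of the principal parts and an analytic function. -/
theorem exists_analyticAt_add_sum_principalPart {f : ℂ → ℂ} {U : Set ℂ} (T : Finset ℂ)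
    (α β : ℂ → ℂ) (hf : ∀ z ∈ U, z ∉ T → AnalyticAt ℂ f z)
    (hT : ∀ a ∈ T, HasPrincipalPart f a (α a) (β a)) :
    ∃ h : ℂ → ℂ, (∀ z ∈ U, AnalyticAt ℂ h z) ∧
      ∀ z ∈ U, z ∉ T → f z = h z + ∑ a ∈ T, (α a / (z - a) ^ 2 + β a / (z - a)) := by
  set g : ℂ → ℂ := fun z => f z - ∑ a ∈ T, (α a / (z - a) ^ 2 + β a / (z - a)) with hg
  have hterm : ∀ a z, z ≠ a →
      AnalyticAt ℂ (fun z : ℂ => α a / (z - a) ^ 2 + β a / (z - a)) z := fun a z hza => by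
    have : z - a ≠ 0 := sub_ne_zero.mpr hza
    exact AnalyticAt.add (AnalyticAt.div (by fun_prop) (by fun_prop) (pow_ne_zero 2 this))
      (AnalyticAt.div (by fun_prop) (by fun_prop) this)
  have hsum : ∀ S : Finset ℂ, ∀ z ∉ S,
      AnalyticAt ℂ (fun z : ℂ => ∑ a ∈ S, (α a / (z - a) ^ 2 + β a / (z - a))) z := fun S z hz =>
    Finset.analyticAt_fun_sum _ fun a ha => hterm a z fun h => hz (h ▸ ha)
  have hloc : ∀ b ∈ U, ∃ φ, AnalyticAt ℂ φ b ∧ (b ∉ T → g b = φ b) ∧ g =ᶠ[𝓝[≠] b] φ := by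
    intro b hb
    by_cases hbT : b ∈ T
    · obtain ⟨φ, hφ, h⟩ := hT b hbT
      refine ⟨fun z => φ z - ∑ a ∈ T.erase b, (α a / (z - a) ^ 2 + β a / (z - a)),
        hφ.sub (hsum _ b (by simp)), fun h => absurd hbT h, ?_⟩
      filter_upwards [h] with z hz
      rw [hg]
      simp only
      rw [← Finset.add_sum_erase _ _ hbT, hz]
      ring
    · exact ⟨g, (hf b hb hbT).sub (hsum _ b hbT), fun _ => rfl, EventuallyEq.rfl⟩
  -- The punctured limit fills in the removable singularities of `g` and returns `g` elsewhere in
  -- `U`.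
  refine ⟨fun z => limUnder (𝓝[≠] z) g, fun b hb => ?_, fun b hb hbT => ?_⟩
  · obtain ⟨φ, hφ, -, h⟩ := hloc b hb
    refine hφ.congr ?_
    filter_upwards [eventually_eventually_nhds.mpr (eventually_nhdsWithin_iff.mp h),
      hφ.eventually_analyticAt] with z hz hφz
    have hgz : g =ᶠ[𝓝[≠] z] φ := by
      rcases eq_or_ne z b with rfl | hzb
      · exact h
      · filter_upwards [mem_nhdsWithin_of_mem_nhds hz,
          mem_nhdsWithin_of_mem_nhds (isOpen_ne.mem_nhds hzb)] with w hw hwb using hw hwb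
    exact ((hφz.continuousAt.tendsto.mono_left nhdsWithin_le_nhds).congr' hgz.symm).limUnder_eq.symm
  · obtain ⟨φ, hφ, h1, h⟩ := hloc b hb
    have : limUnder (𝓝[≠] b) g = φ b :=
      ((hφ.continuousAt.tendsto.mono_left nhdsWithin_le_nhds).congr' h.symm).limUnder_eq
    change f b = limUnder (𝓝[≠] b) g + _
    rw [this, ← h1 hbT, hg, sub_add_cancel]

/-- A solution of `q' = (α / (z - a)² + n / (z - a)) q`. -/
def elementaryFactor (a α : ℂ) (n : ℤ) (z : ℂ) : ℂ :=
  Complex.exp (-α / (z - a)) * (z - a) ^ n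

theorem elementaryFactor_ne_zero {a α z : ℂ} {n : ℤ} (h : z ≠ a) : elementaryFactor a α n z ≠ 0 :=
  mul_ne_zero (Complex.exp_ne_zero _) (zpow_ne_zero _ (sub_ne_zero.mpr h))

theorem hasDerivAt_elementaryFactor {a α z : ℂ} {n : ℤ} (h : z ≠ a) :
    HasDerivAt (elementaryFactor a α n)
      ((α / (z - a) ^ 2 + n / (z - a)) * elementaryFactor a α n z) z := by
  have h0 : z - a ≠ 0 := sub_ne_zero.mpr h
  have hs : HasDerivAt (fun z => z - a) 1 z := (hasDerivAt_id z).sub_const a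
  have h1 := (((hasDerivAt_const z (-α)).div hs h0).cexp).mul
    ((hasDerivAt_zpow n (z - a) (Or.inl h0)).comp z hs)
  convert! h1 using 1
  simp only [elementaryFactor, Function.comp, Pi.div_apply]
  rw [zpow_sub_one₀ h0]
  field_simp
  ring

theorem differentiableAt_elementaryFactor_self {a α : ℂ} {n : ℤ} (hα : α = 0) (hn : 0 ≤ n) :
    DifferentiableAt ℂ (elementaryFactor a α n) a := by
  subst hα
  lift n to ℕ using hn
  have : elementaryFactor a 0 n = fun z => (z - a) ^ n := by
    ext z
    simp [elementaryFactor]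
  rw [this]
  fun_prop

theorem hasDerivAt_prod_of_hasDerivAt_mul_self {ι : Type*} (T : Finset ι) {q : ι → ℂ → ℂ}
    {m : ι → ℂ} {z : ℂ} (h : ∀ i ∈ T, HasDerivAt (q i) (m i * q i z) z) :
    HasDerivAt (fun w => ∏ i ∈ T, q i w) ((∑ i ∈ T, m i) * ∏ i ∈ T, q i z) z := by
  classical
  induction T using Finset.induction_on with
  | empty => simpa using hasDerivAt_const z (1 : ℂ)
  | insert a T ha ih =>
    simp only [Finset.prod_insert ha, Finset.sum_insert ha]
    convert! (h a (Finset.mem_insert_self a T)).mul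
      (ih fun i hi => h i (Finset.mem_insert_of_mem hi)) using 1
    ring

theorem finite_inter_of_eventually_notMem {S K : Set ℂ} (hK : IsCompact K)
    (hS : ∀ z, ∀ᶠ w in 𝓝[≠] z, w ∉ S) : (S ∩ K).Finite := by
  by_contra h
  obtain ⟨z, -, hz⟩ := Set.Infinite.exists_accPt_of_subset_isCompact h hK inter_subset_right
  rw [accPt_iff_frequently_nhdsNE] at hz
  exact hz ((hS z).mono fun w hw hwS => hw hwS.1)

theorem countable_of_eventually_notMem {S : Set ℂ} (hS : ∀ z, ∀ᶠ w in 𝓝[≠] z, w ∉ S) :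
    S.Countable := by
  have : S = ⋃ n : ℕ, S ∩ Metric.closedBall 0 n := by
    rw [← inter_iUnion, Metric.iUnion_closedBall_nat, inter_univ]
  rw [this]
  exact countable_iUnion fun n =>
    (finite_inter_of_eventually_notMem (isCompact_closedBall _ _) hS).countable

theorem eventually_notMem_of_notMem {S : Set ℂ} (hS : ∀ z, ∀ᶠ w in 𝓝[≠] z, w ∉ S) {z : ℂ}
    (hz : z ∉ S) : ∀ᶠ w in 𝓝 z, w ∉ S := by
  filter_upwards [eventually_nhdsWithin_iff.mp (hS z)] with w hw
  by_cases h : w = z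
  · rwa [h]
  · exact hw h

/-- On the set `U`, the function `P` is a solution of `P' = f P`, nonvanishing off `S`, and it
extends to the points of `S` where the principal part of `f` is `n / (z - a)` with `0 ≤ n`. -/
structure IsIntegratingFactorOn (P f : ℂ → ℂ) (S : Set ℂ) (α : ℂ → ℂ) (n : ℂ → ℤ) (U : Set ℂ) :
    Prop where
  differentiableAt : ∀ z ∈ U, (z ∈ S → α z = 0 ∧ 0 ≤ n z) → DifferentiableAt ℂ P z
  ne_zero : ∀ z ∈ U, z ∉ S → P z ≠ 0
  hasDerivAt : ∀ z ∈ U, z ∉ S → HasDerivAt P (f z * P z) z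

section IntegratingFactor

variable {f : ℂ → ℂ} {S : Set ℂ} {α : ℂ → ℂ} {n : ℂ → ℤ}

/-- Only finitely many poles matter. Each contributes an explicit factor, single-valued because `n`
is an integer; what is left of `f` is holomorphic on the ball, so has a primitive to exponentiate.
-/
theorem exists_isIntegratingFactorOn_ball (hS : ∀ z, ∀ᶠ w in 𝓝[≠] z, w ∉ S)
    (hf : ∀ z ∉ S, AnalyticAt ℂ f z) (hp : ∀ a ∈ S, HasPrincipalPart f a (α a) (n a)) (R : ℝ) :
    ∃ P, IsIntegratingFactorOn P f S α n (Metric.ball 0 R) := by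
  set T := (finite_inter_of_eventually_notMem (isCompact_closedBall 0 R) hS).toFinset with hT
  have hTS : ∀ a ∈ T, a ∈ S := fun a ha => by
    rw [hT, Set.Finite.mem_toFinset] at ha
    exact ha.1
  have hST : ∀ a ∈ Metric.ball (0 : ℂ) R, a ∈ S → a ∈ T := fun a ha haS => by
    rw [hT, Set.Finite.mem_toFinset]
    exact ⟨haS, Metric.ball_subset_closedBall ha⟩
  obtain ⟨h, hh, hfh⟩ := exists_analyticAt_add_sum_principalPart (f := f) (U := Metric.ball 0 R) T α
    (fun a => n a) (fun z hz hzT => hf z fun hzS => hzT (hST z hz hzS))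
    (fun a ha => hp a (hTS a ha))
  obtain ⟨g, hg⟩ := DifferentiableOn.isExactOn_ball (f := h) (c := 0) (r := R)
    fun z hz => (hh z hz).differentiableAt.differentiableWithinAt
  have hexp : ∀ z ∈ Metric.ball (0 : ℂ) R,
      HasDerivAt (fun z => Complex.exp (g z)) (Complex.exp (g z) * h z) z := fun z hz =>
    (hg z hz).cexp
  refine ⟨fun z => Complex.exp (g z) * ∏ a ∈ T, elementaryFactor a (α a) (n a) z, ?_, ?_, ?_⟩
  · intro z hz hzS
    refine (hexp z hz).differentiableAt.mul (DifferentiableAt.fun_finsetProd fun a ha => ?_)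
    rcases eq_or_ne z a with rfl | hza
    · exact differentiableAt_elementaryFactor_self (hzS (hTS z ha)).1 (hzS (hTS z ha)).2
    · exact (hasDerivAt_elementaryFactor hza).differentiableAt
  · intro z hz hzS
    exact mul_ne_zero (Complex.exp_ne_zero _) (Finset.prod_ne_zero_iff.mpr fun a ha =>
      elementaryFactor_ne_zero fun hza => hzS (hza ▸ hTS a ha))
  · intro z hz hzS
    have h1 := (hexp z hz).mul (hasDerivAt_prod_of_hasDerivAt_mul_self T fun a ha =>
      hasDerivAt_elementaryFactor (α := α a) (n := n a) fun hza => hzS (hza ▸ hTS a ha))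
    convert! h1 using 1
    rw [hfh z hz fun hzT => hzS (hTS z hzT)]
    ring

/-- The ratio of two solutions has zero derivative on the connected set `U \ S`; at a point of `S`
over which both extend, equality follows by continuity. -/
theorem IsIntegratingFactorOn.eqOn {P Q : ℂ → ℂ} {U : Set ℂ} {w z : ℂ}
    (hP : IsIntegratingFactorOn P f S α n U) (hQ : IsIntegratingFactorOn Q f S α n U)
    (hS : ∀ z, ∀ᶠ w in 𝓝[≠] z, w ∉ S) (hU : IsOpen U) (hUS : IsPreconnected (U \ S))
    (hw : w ∈ U \ S) (hPQ : P w = Q w) (hz : z ∈ U) (hzS : z ∈ S → α z = 0 ∧ 0 ≤ n z) :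
    P z = Q z := by
  have hopen : IsOpen (U \ S) := by
    refine isOpen_iff_mem_nhds.mpr fun y hy => ?_
    filter_upwards [hU.mem_nhds hy.1, eventually_notMem_of_notMem hS hy.2] with x h1 h2
      using ⟨h1, h2⟩
  have hd : ∀ y ∈ U \ S, HasDerivAt (fun y => P y / Q y) 0 y := by
    intro y hy
    convert! (hP.hasDerivAt y hy.1 hy.2).div (hQ.hasDerivAt y hy.1 hy.2)
      (hQ.ne_zero y hy.1 hy.2) using 1
    ring
  have hoff : ∀ y ∈ U, y ∉ S → P y = Q y := by
    intro y hy hyS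
    have := hopen.is_const_of_deriv_eq_zero hUS
      (fun y hy => (hd y hy).differentiableAt.differentiableWithinAt)
      (fun y hy => (hd y hy).deriv) ⟨hy, hyS⟩ hw
    simp only [hPQ, div_self (hQ.ne_zero w hw.1 hw.2)] at this
    exact (div_eq_one_iff_eq (hQ.ne_zero y hy hyS)).mp this
  have hlim : P =ᶠ[𝓝[≠] z] Q := by
    filter_upwards [hS z, mem_nhdsWithin_of_mem_nhds (hU.mem_nhds hz)] with y h1 h2
      using hoff y h2 h1
  exact tendsto_nhds_unique
    (((hP.differentiableAt z hz hzS).continuousAt.tendsto.mono_left nhdsWithin_le_nhds).congr' hlim)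
    ((hQ.differentiableAt z hz hzS).continuousAt.tendsto.mono_left nhdsWithin_le_nhds)

theorem IsIntegratingFactorOn.mono {P : ℂ → ℂ} {U V : Set ℂ}
    (hP : IsIntegratingFactorOn P f S α n U) (h : V ⊆ U) : IsIntegratingFactorOn P f S α n V :=
  ⟨fun z hz => hP.differentiableAt z (h hz), fun z hz => hP.ne_zero z (h hz),
    fun z hz => hP.hasDerivAt z (h hz)⟩

theorem IsIntegratingFactorOn.const_mul {P : ℂ → ℂ} {U : Set ℂ}
    (hP : IsIntegratingFactorOn P f S α n U) {k : ℂ} (hk : k ≠ 0) :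
    IsIntegratingFactorOn (fun z => k * P z) f S α n U :=
  ⟨fun z hz h => (hP.differentiableAt z hz h).const_mul k,
    fun z hz h => mul_ne_zero hk (hP.ne_zero z hz h),
    fun z hz h => by
      convert! (hP.hasDerivAt z hz h).const_mul k using 1
      ring⟩

/-- A meromorphic function whose poles have integral residues and order at most two is, on the
whole plane, the logarithmic derivative of a function with isolated singularities. -/
theorem exists_isIntegratingFactorOn_univ (hS : ∀ z, ∀ᶠ w in 𝓝[≠] z, w ∉ S)
    (hf : ∀ z ∉ S, AnalyticAt ℂ f z) (hp : ∀ a ∈ S, HasPrincipalPart f a (α a) (n a))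
    {w : ℂ} (hw : w ∉ S) {y : ℂ} (hy : y ≠ 0) :
    ∃ P, P w = y ∧ IsIntegratingFactorOn P f S α n univ := by
  have hSc := countable_of_eventually_notMem hS
  -- All balls contain `w`, so normalizing every solution to `y` at `w` makes them compatible.
  set R : ℕ → ℝ := fun k => ‖w‖ + 1 + k with hR
  have hmono : ∀ j k : ℕ, j ≤ k → Metric.ball (0 : ℂ) (R j) ⊆ Metric.ball 0 (R k) := fun j k h =>
    Metric.ball_subset_ball (by simpa [hR] using h)
  have hwR : ∀ k, w ∈ Metric.ball (0 : ℂ) (R k) := fun k => by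
    rw [mem_ball_zero_iff, hR]
    have : (0 : ℝ) ≤ k := k.cast_nonneg
    linarith
  have hex : ∀ k : ℕ, ∃ P, P w = y ∧ IsIntegratingFactorOn P f S α n (Metric.ball 0 (R k)) := by
    intro k
    obtain ⟨P, hP⟩ := exists_isIntegratingFactorOn_ball hS hf hp (R k)
    have h0 := hP.ne_zero w (hwR k) hw
    exact ⟨fun z => y / P w * P z, div_mul_cancel₀ y h0, hP.const_mul (div_ne_zero hy h0)⟩
  choose Q hQw hQ using hex
  have hagree : ∀ j k : ℕ, j ≤ k → ∀ z ∈ Metric.ball (0 : ℂ) (R j),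
      (z ∈ S → α z = 0 ∧ 0 ≤ n z) → Q j z = Q k z := fun j k hjk z hz hzS =>
    (hQ j).eqOn ((hQ k).mono (hmono j k hjk)) hS Metric.isOpen_ball
      (isPreconnected_ball_diff_countable 0 _ hSc) ⟨hwR j, hw⟩ ((hQw j).trans (hQw k).symm) hz hzS
  have hmem : ∀ z : ℂ, z ∈ Metric.ball (0 : ℂ) (R ⌈‖z‖⌉₊) := fun z => by
    rw [mem_ball_zero_iff, hR]
    have := Nat.le_ceil ‖z‖
    have := norm_nonneg w
    linarith
  set P : ℂ → ℂ := fun z => Q ⌈‖z‖⌉₊ z with hP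
  -- The index in the definition of `P` jumps with `⌈‖z‖⌉₊`; near `z` it exceeds its value at `z` by
  -- at most one, and the solutions on nested balls agree.
  have hloc : ∀ z, (z ∈ S → α z = 0 ∧ 0 ≤ n z) → P =ᶠ[𝓝 z] Q (⌈‖z‖⌉₊ + 1) := by
    intro z hz
    have h1 : ∀ᶠ x in 𝓝 z, ‖x‖ < ‖z‖ + 1 :=
      continuous_norm.continuousAt.eventually (gt_mem_nhds (lt_add_one ‖z‖))
    filter_upwards [h1, eventually_nhdsWithin_iff.mp (hS z)] with x hx hxS
    refine hagree _ _ ?_ x (hmem x) fun h => ?_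
    · refine Nat.ceil_le.mpr (hx.le.trans ?_)
      push_cast
      linarith [Nat.le_ceil ‖z‖]
    · by_cases hxz : x = z
      · subst hxz
        exact hz h
      · exact absurd h (hxS hxz)
  have hmem' : ∀ z : ℂ, z ∈ Metric.ball (0 : ℂ) (R (⌈‖z‖⌉₊ + 1)) := fun z =>
    hmono _ _ (Nat.le_succ _) (hmem z)
  refine ⟨P, hQw _, fun z _ hz => ?_, fun z _ hz => ?_, fun z _ hz => ?_⟩
  · exact ((hQ _).differentiableAt z (hmem' z) hz).congr_of_eventuallyEq (hloc z hz)
  · exact (hQ _).ne_zero z (hmem z) hz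
  · have h := hloc z fun h => absurd h hz
    rw [h.self_of_nhds]
    exact ((hQ _).hasDerivAt z (hmem' z) hz).congr_of_eventuallyEq h

end IntegratingFactor

/-! ### Equations of motion, conserved quantities and the Weierstrass parametrization. -/

namespace Schwarzschild

theorem hasDerivAt_Q (x : ℝ) : HasDerivAt Q (3 * x ^ 2 / 2 - 1 / 6) x := by
  have h := ((((hasDerivAt_id x).pow 3).div_const 2).sub ((hasDerivAt_id x).div_const 6)).sub_const
    (1 / 27)
  convert! h using 1
  simp

namespace IsNullGeodesic

variable {I : Set ℝ} {u ω U Ω : ℝ → ℝ} {x p : ℝ → EuclideanSpace ℝ (Fin 3)}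
  (hgeo : IsNullGeodesic I u ω U Ω x p)
include hgeo

theorem hasDerivAt_u {s : ℝ} (hs : s ∈ I) : HasDerivAt u (Ω s) s := by
  convert! hgeo.hamilton_u s hs using 1
  have h := (((hasDerivAt_id (U s)).add_const (Q (ω s) * Ω s)).const_mul (Ω s)).deriv
  change _ = deriv (fun y => Ω s * (id y + Q (ω s) * Ω s)) (U s)
  rw [h, mul_one]

theorem hasDerivAt_ω {s : ℝ} (hs : s ∈ I) : HasDerivAt ω (U s + 2 * Q (ω s) * Ω s) s := by
  convert! hgeo.hamilton_ω s hs using 1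
  have h := (hasDerivAt_id (Ω s)).mul (((hasDerivAt_id (Ω s)).const_mul (Q (ω s))).const_add (U s))
  have h2 := h.deriv
  change _ = deriv (id * fun y => U s + Q (ω s) * id y) (Ω s)
  rw [h2]
  simp only [id]
  ring

theorem hasDerivAt_U {s : ℝ} (hs : s ∈ I) : HasDerivAt U 0 s := by
  convert! hgeo.hamilton_U s hs using 1
  simp [stringHamiltonian]

theorem hasDerivAt_Ω {s : ℝ} (hs : s ∈ I) :
    HasDerivAt Ω (-((3 * ω s ^ 2 / 2 - 1 / 6) * Ω s ^ 2)) s := by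
  convert! hgeo.hamilton_Ω s hs using 2
  have h := (((hasDerivAt_Q (ω s)).mul_const (Ω s)).const_add (U s)).const_mul (Ω s)
  have h2 := h.deriv
  change _ = deriv (fun y => Ω s * (U s + Q y * Ω s)) (ω s)
  rw [h2]
  ring

theorem momentum_eq (hI : IsOpen I) (hI' : IsPreconnected I) {s t : ℝ} (hs : s ∈ I) (ht : t ∈ I) :
    U s = U t :=
  hI.is_const_of_deriv_eq_zero hI'
    (fun _ hr => (hgeo.hasDerivAt_U hr).differentiableAt.differentiableWithinAt)
    (fun _ hr => (hgeo.hasDerivAt_U hr).deriv) hs ht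

theorem energy_eq (hI : IsOpen I) (hI' : IsPreconnected I) {s t : ℝ} (hs : s ∈ I) (ht : t ∈ I) :
    stringHamiltonian (u s) (ω s) (U s) (Ω s) = stringHamiltonian (u t) (ω t) (U t) (Ω t) := by
  have hd : ∀ r ∈ I, HasDerivAt (fun r => stringHamiltonian (u r) (ω r) (U r) (Ω r)) 0 r := by
    intro r hr
    have hΩ := hgeo.hasDerivAt_Ω hr
    have h := hΩ.mul ((hgeo.hasDerivAt_U hr).add
      (((hasDerivAt_Q (ω r)).comp r (hgeo.hasDerivAt_ω hr)).mul hΩ))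
    convert! h using 1
    simp only [Function.comp, Pi.add_apply, Pi.mul_apply]
    ring
  exact hI.is_const_of_deriv_eq_zero hI'
    (fun r hr => (hd r hr).differentiableAt.differentiableWithinAt)
    (fun r hr => (hd r hr).deriv) hs ht

variable {H U₀ κ : ℝ} {L : PeriodPair}

/-- The pair `(ω, dω/dz)` satisfies the equations of motion of `(℘, ℘')`. -/
theorem hasDerivAt_weierstrassField (hκ : κ ≠ 0) (hκH : κ ^ 2 = H / 2) (hg₂ : L.g₂ = 4 / 3)
    (hH : ∀ s ∈ I, stringHamiltonian (u s) (ω s) (U s) (Ω s) = H) {s : ℝ} (hs : s ∈ I) :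
    HasDerivAt (fun s => ((ω s : ℂ), (((U s + 2 * Q (ω s) * Ω s) / κ : ℝ) : ℂ)))
      (L.weierstrassField κ ((ω s : ℂ), (((U s + 2 * Q (ω s) * Ω s) / κ : ℝ) : ℂ))) s := by
  have h1 := (hgeo.hasDerivAt_ω hs).ofReal_comp
  have h2 := (((hgeo.hasDerivAt_U hs).add (((((hasDerivAt_Q (ω s)).comp s
    (hgeo.hasDerivAt_ω hs)).const_mul 2)).mul (hgeo.hasDerivAt_Ω hs))).div_const κ).ofReal_comp
  convert! h1.prodMk h2 using 1
  -- Hamilton's equations give `ω'' = 2Q'(ω)·Ω(U + QΩ) = 2HQ'(ω)`; in the parameter `z` this is `6ω²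
  -- - 2/3 = 6ω² - g₂/2`. The invariant `g₃` enters only through the initial data.
  have hE := hH s hs
  rw [stringHamiltonian] at hE
  simp only [PeriodPair.weierstrassField, hg₂]
  congr 1
  · rw [← Complex.ofReal_mul, mul_div_cancel₀ _ hκ]
  · rw [show (κ : ℂ) * (6 * (ω s : ℂ) ^ 2 - 4 / 3 / 2) = ((κ * (6 * ω s ^ 2 - 2 / 3) : ℝ) : ℂ) by
      push_cast; ring]
    congr 1
    rw [eq_div_iff hκ]
    simp only [Function.comp]
    linear_combination (6 * ω s ^ 2 - 2 / 3) * hκH - (3 * ω s ^ 2 - 1 / 3) * hE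

/-- Continuity argument on the connected set `I`: agreement is open by ODE uniqueness, and closed
because `ω` stays bounded near each time in `I`, so the line cannot run into a pole of `℘`. -/
theorem weierstrassP_eq (hI : IsOpen I) (hI' : IsPreconnected I) (hκ : κ ≠ 0)
    (hκH : κ ^ 2 = H / 2) (hg₂ : L.g₂ = 4 / 3)
    (hH : ∀ s ∈ I, stringHamiltonian (u s) (ω s) (U s) (Ω s) = H) {b : ℂ} {s₀ : ℝ}
    (hs₀ : s₀ ∈ I) (hb : (s₀ : ℂ) * κ + b ∉ L.lattice)
    (h : L.weierstrassP (s₀ * κ + b) = ω s₀)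
    (h' : L.derivWeierstrassP (s₀ * κ + b) = ((U s₀ + 2 * Q (ω s₀) * Ω s₀) / κ : ℝ))
    {s : ℝ} (hs : s ∈ I) :
    (s : ℂ) * κ + b ∉ L.lattice ∧ L.weierstrassP (s * κ + b) = ω s ∧
      L.derivWeierstrassP (s * κ + b) = ((U s + 2 * Q (ω s) * Ω s) / κ : ℝ) := by
  set y : ℝ → ℂ × ℂ := fun s => ((ω s : ℂ), (((U s + 2 * Q (ω s) * Ω s) / κ : ℝ) : ℂ)) with hy
  set q : ℝ → ℂ × ℂ := fun s =>
    (L.weierstrassP (s * κ + b), L.derivWeierstrassP (s * κ + b)) with hq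
  set A : Set ℝ := {s | s ∈ I ∧ (s : ℂ) * κ + b ∉ L.lattice ∧ q s = y s} with hA
  have hline : Continuous fun s : ℝ => (s : ℂ) * κ + b := by fun_prop
  have hyd := fun s (hs : s ∈ I) => hgeo.hasDerivAt_weierstrassField hκ hκH hg₂ hH hs
  have hlat : ∀ t : ℝ, (t : ℂ) * κ + b ∉ L.lattice → ∀ᶠ r : ℝ in 𝓝 t, (r : ℂ) * κ + b ∉ L.lattice :=
    fun t ht => hline.continuousAt.eventually (L.eventually_notMem_lattice ht)
  have hsub : I ⊆ A := by
    refine hI'.subset_of_closure_inter_subset ?_ ⟨s₀, hs₀, hs₀, hb, Prod.ext h h'⟩ ?_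
    · rw [isOpen_iff_mem_nhds]
      rintro t ⟨ht, htL, hqy⟩
      have h1 := eventuallyEq_of_hasDerivAt_contDiffAt (f := q) (g := y)
        (L.contDiff_weierstrassField κ).contDiffAt
        ((hlat t htL).mono fun r hr => L.hasDerivAt_weierstrassP_line hr)
        ((hI.eventually_mem ht).mono hyd) hqy
      filter_upwards [hI.mem_nhds ht, hlat t htL, h1] with r h1 h2 h3 using ⟨h1, h2, h3⟩
    · rintro t ⟨htA, ht⟩
      have hne := mem_closure_iff_nhdsWithin_neBot.mp htA
      have hyt : Tendsto y (𝓝[A] t) (𝓝 (y t)) :=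
        (hyd t ht).continuousAt.tendsto.mono_left nhdsWithin_le_nhds
      have heq : q =ᶠ[𝓝[A] t] y := by
        filter_upwards [self_mem_nhdsWithin] with r hr using hr.2.2
      by_cases htL : (t : ℂ) * κ + b ∈ L.lattice
      · exfalso
        have hle : Tendsto (fun r : ℝ => (r : ℂ) * κ + b) (𝓝[A] t) (𝓝[≠] ((t : ℂ) * κ + b)) := by
          refine tendsto_nhdsWithin_iff.mpr ⟨hline.continuousAt.tendsto.mono_left
            nhdsWithin_le_nhds, ?_⟩
          filter_upwards [self_mem_nhdsWithin] with r hr h0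
          exact hr.2.1 (h0 ▸ htL)
        have h1 := (L.tendsto_weierstrassP_cobounded htL).comp hle
        have h2 : Tendsto (fun r => (q r).1) (𝓝[A] t) (𝓝 (y t).1) :=
          (continuous_fst.tendsto _).comp (hyt.congr' heq.symm)
        exact h2.not_tendsto (Metric.disjoint_nhds_cobounded _) h1
      · have hqt : Tendsto q (𝓝[A] t) (𝓝 (q t)) :=
          (L.hasDerivAt_weierstrassP_line htL).continuousAt.tendsto.mono_left nhdsWithin_le_nhds
        exact ⟨ht, htL, tendsto_nhds_unique hqt (hyt.congr' heq.symm)⟩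
  obtain ⟨-, h1, h2⟩ := hsub hs
  exact ⟨h1, congrArg Prod.fst h2, congrArg Prod.snd h2⟩

end IsNullGeodesic

/-- The kernel of `a ↦ exp(a/2)` is `4πiℤ`, so classes modulo the period are nonzero values of
`exp(u/2)`. -/
theorem coe_eq_coe_period_iff {a b : ℂ} :
    (a : ℂ ⧸ period) = b ↔ Complex.exp (a / 2) = Complex.exp (b / 2) := by
  rw [QuotientAddGroup.eq, period, AddSubgroup.mem_zmultiples_iff, eq_comm (a := Complex.exp _),
    Complex.exp_eq_exp_iff_exists_int]
  refine exists_congr fun n => ?_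
  rw [zsmul_eq_mul]
  constructor <;> intro h
  · linear_combination -h / 2
  · linear_combination -2 * h

end Schwarzschild

/-! ### The poles of `F dz` on the elliptic curve and the integrating factor of `F/2`. -/

namespace PeriodPair

variable {L : PeriodPair} {c a₁ a₂ : ℂ}

theorem weierstrassP_eq_of_sub_mem {a b : ℂ} (h : a - b ∈ L.lattice) :
    L.weierstrassP a = L.weierstrassP b ∧ L.derivWeierstrassP a = L.derivWeierstrassP b := by
  have h1 := L.weierstrassP_add_coe b ⟨a - b, h⟩
  have h2 := L.derivWeierstrassP_add_coe b ⟨a - b, h⟩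
  simp only [add_sub_cancel] at h1 h2
  exact ⟨h1, h2⟩

theorem notMem_lattice_of_sub_mem {a b : ℂ} (h : a - b ∈ L.lattice) (hb : b ∉ L.lattice) :
    a ∉ L.lattice := fun ha => hb (by simpa using sub_mem ha h)

/-- `a₁` and `a₂` are the simple and the double zero of `℘' + c` on the curve with invariants
`g₂ = 4/3` and `g₃ = 8/27 - c²`. -/
structure IsZeroPair (L : PeriodPair) (c a₁ a₂ : ℂ) : Prop where
  g₂_eq : L.g₂ = 4 / 3
  g₃_eq : L.g₃ = 8 / 27 - c ^ 2
  ne_zero : c ≠ 0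
  notMem₁ : a₁ ∉ L.lattice
  notMem₂ : a₂ ∉ L.lattice
  weierstrassP₁ : L.weierstrassP a₁ = 2 / 3
  weierstrassP₂ : L.weierstrassP a₂ = -1 / 3
  deriv₁ : L.derivWeierstrassP a₁ = -c
  deriv₂ : L.derivWeierstrassP a₂ = -c

theorem exists_isZeroPair (hg₂ : L.g₂ = 4 / 3) (hg₃ : L.g₃ = 8 / 27 - c ^ 2) (hc : c ≠ 0) :
    ∃ a₁ a₂, IsZeroPair L c a₁ a₂ := by
  obtain ⟨a₁, h1, h2, h3⟩ := L.exists_weierstrassP_eq_and_derivWeierstrassP_eq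
    (x := 2 / 3) (y := -c) (by rw [hg₂, hg₃]; ring)
  obtain ⟨a₂, h4, h5, h6⟩ := L.exists_weierstrassP_eq_and_derivWeierstrassP_eq
    (x := -1 / 3) (y := -c) (by rw [hg₂, hg₃]; ring)
  exact ⟨a₁, a₂, hg₂, hg₃, hc, h1, h4, h2, h5, h3, h6⟩

namespace IsZeroPair

theorem hasPrincipalPart_simple (h : IsZeroPair L c a₁ a₂) (z₀ : ℂ) {z : ℂ}
    (hz : z - (z₀ + a₁) ∈ L.lattice) :
    HasPrincipalPart (fun z => L.fourDivDeriv c (z - z₀)) z 0 2 := by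
  rw [← sub_sub] at hz
  have h1 := hasPrincipalPart_fourDivDeriv_simple h.g₂_eq h.g₃_eq h.ne_zero
    (notMem_lattice_of_sub_mem hz h.notMem₁)
    ((weierstrassP_eq_of_sub_mem hz).1.trans h.weierstrassP₁)
    ((weierstrassP_eq_of_sub_mem hz).2.trans h.deriv₁)
  simpa using h1.comp_sub z₀

theorem hasPrincipalPart_double (h : IsZeroPair L c a₁ a₂) (z₀ : ℂ) {z : ℂ}
    (hz : z - (z₀ + a₂) ∈ L.lattice) :
    HasPrincipalPart (fun z => L.fourDivDeriv c (z - z₀)) z (2 / c) (-2) := by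
  rw [← sub_sub] at hz
  have h1 := hasPrincipalPart_fourDivDeriv_double h.g₂_eq h.g₃_eq h.ne_zero
    (notMem_lattice_of_sub_mem hz h.notMem₂)
    ((weierstrassP_eq_of_sub_mem hz).1.trans h.weierstrassP₂)
    ((weierstrassP_eq_of_sub_mem hz).2.trans h.deriv₂)
  simpa using h1.comp_sub z₀

/-- A zero of `℘' + c` lies over one of two points of the cubic, and `(℘, ℘')` is injective modulo
the lattice. -/
theorem derivWeierstrassP_add_ne_zero (h : IsZeroPair L c a₁ a₂) {w : ℂ} (hw : w ∉ L.lattice)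
    (h1 : w - a₁ ∉ L.lattice) (h2 : w - a₂ ∉ L.lattice) : L.derivWeierstrassP w + c ≠ 0 := by
  intro h0
  have h0 : L.derivWeierstrassP w = -c := eq_neg_of_add_eq_zero_left h0
  rcases weierstrassP_eq_of_derivWeierstrassP_eq h.g₂_eq h.g₃_eq hw h0 with h3 | h3
  · exact h1 (L.sub_mem_lattice_of_weierstrassP_eq h.notMem₁ hw (h3.trans h.weierstrassP₁.symm)
      (h0.trans h.deriv₁.symm))
  · exact h2 (L.sub_mem_lattice_of_weierstrassP_eq h.notMem₂ hw (h3.trans h.weierstrassP₂.symm)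
      (h0.trans h.deriv₂.symm))

theorem analyticAt (h : IsZeroPair L c a₁ a₂) (z₀ : ℂ) {z : ℂ}
    (hz : z ∈ Schwarzschild.regularSet L (z₀ + a₁) (z₀ + a₂)) :
    AnalyticAt ℂ (fun z => L.fourDivDeriv c (z - z₀)) z := by
  refine AnalyticAt.fun_comp (g := L.fourDivDeriv c) (f := fun z => z - z₀) ?_ (by fun_prop)
  obtain ⟨h1, h2⟩ := hz
  rw [← sub_sub] at h1 h2
  by_cases hL : z - z₀ ∈ L.lattice
  · exact analyticAt_fourDivDeriv_of_mem hL
  · exact analyticAt_fourDivDeriv_of_notMem hL (h.derivWeierstrassP_add_ne_zero hL h1 h2)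

theorem hasSimpleAndDoublePole (h : IsZeroPair L c a₁ a₂) (z₀ : ℂ) :
    Schwarzschild.HasSimpleAndDoublePole L (fun z => L.fourDivDeriv c (z - z₀))
      (z₀ + a₁) (z₀ + a₂) where
  periodic l hl z := by rw [add_sub_right_comm, fourDivDeriv_add hl]
  meromorphic z := by
    by_cases h1 : z - (z₀ + a₁) ∈ L.lattice
    · exact (h.hasPrincipalPart_simple z₀ h1).meromorphicAt
    by_cases h2 : z - (z₀ + a₂) ∈ L.lattice
    · exact (h.hasPrincipalPart_double z₀ h2).meromorphicAt
    · exact (h.analyticAt z₀ ⟨h1, h2⟩).meromorphicAt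
  analyticAt z hz := h.analyticAt z₀ hz
  order_simple z hz := (h.hasPrincipalPart_simple z₀ hz).meromorphicOrderAt_simple two_ne_zero
  order_double z hz := (h.hasPrincipalPart_double z₀ hz).meromorphicOrderAt_double
    (div_ne_zero two_ne_zero h.ne_zero)
  residue_simple z hz := (h.hasPrincipalPart_simple z₀ hz).hasResidue
  residue_double z hz := (h.hasPrincipalPart_double z₀ hz).hasResidue

theorem _root_.Schwarzschild.eventually_mem_regularSet (L : PeriodPair) (z₁ z₂ z : ℂ) :
    ∀ᶠ w in 𝓝[≠] z, w ∈ Schwarzschild.regularSet L z₁ z₂ := by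
  have key : ∀ b : ℂ, ∀ᶠ w in 𝓝[≠] z, w - b ∉ L.lattice := by
    intro b
    have hT : Tendsto (fun w => w - b) (𝓝[≠] z) (𝓝[≠] (z - b)) := by
      refine tendsto_nhdsWithin_iff.mpr ⟨?_, ?_⟩
      · exact (continuous_sub_right b).continuousAt.tendsto.mono_left nhdsWithin_le_nhds
      · filter_upwards [self_mem_nhdsWithin] with t ht
        simpa using ht
    exact hT.eventually (L.eventually_notMem_lattice_nhdsNE _)
  exact (key z₁).and (key z₂)

theorem exists_integratingFactor (h : IsZeroPair L c a₁ a₂) (z₀ : ℂ) {w : ℂ}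
    (hw : w ∈ Schwarzschild.regularSet L (z₀ + a₁) (z₀ + a₂)) {y : ℂ} (hy : y ≠ 0) :
    ∃ P : ℂ → ℂ, P w = y ∧ DifferentiableOn ℂ P {z | z - (z₀ + a₂) ∉ L.lattice} ∧
      ∀ z ∈ Schwarzschild.regularSet L (z₀ + a₁) (z₀ + a₂),
        P z ≠ 0 ∧ HasDerivAt P (L.fourDivDeriv c (z - z₀) / 2 * P z) z := by
  classical
  -- Halving `F` turns the residues `2` and `-2` into the exponents `1` and `-1`. At the simple
  -- poles `α = 0` and `n = 1`, so `P` extends over them.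
  obtain ⟨P, hPw, hP⟩ := exists_isIntegratingFactorOn_univ
    (f := fun z => 1 / 2 * L.fourDivDeriv c (z - z₀))
    (S := (Schwarzschild.regularSet L (z₀ + a₁) (z₀ + a₂))ᶜ)
    (α := fun z => if z - (z₀ + a₂) ∈ L.lattice then 1 / c else 0)
    (n := fun z => if z - (z₀ + a₂) ∈ L.lattice then -1 else 1)
    (fun z => by
      filter_upwards [Schwarzschild.eventually_mem_regularSet L (z₀ + a₁) (z₀ + a₂) z]
        with w hw using not_not.mpr hw)
    (fun z hz => analyticAt_const.mul (h.analyticAt z₀ (not_not.mp hz)))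
    (fun z hz => by
      by_cases h2 : z - (z₀ + a₂) ∈ L.lattice
      · simp only [h2, if_true]
        convert! (h.hasPrincipalPart_double z₀ h2).const_mul (1 / 2) using 1
        · ring
        · norm_num
      · have h1 : z - (z₀ + a₁) ∈ L.lattice := by
          by_contra h1
          exact hz ⟨h1, h2⟩
        simp only [h2, if_false]
        convert! (h.hasPrincipalPart_simple z₀ h1).const_mul (1 / 2) using 1
        · ring
        · norm_num)
    (not_not.mpr hw) hy
  refine ⟨P, hPw, fun z hz => ?_, fun z hz => ⟨?_, ?_⟩⟩
  · refine (hP.differentiableAt z (mem_univ z) fun _ => ?_).differentiableWithinAt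
    have hz' : z - (z₀ + a₂) ∉ L.lattice := hz
    simp [hz']
  · exact hP.ne_zero z (mem_univ z) (not_not.mpr hz)
  · convert! hP.hasDerivAt z (mem_univ z) (not_not.mpr hz) using 1
    ring

end IsZeroPair

end PeriodPair

/-! ### Holomorphic functions with values in `ℂ/4πiℤ`. -/

namespace Schwarzschild

theorem isOpen_regularSet (L : PeriodPair) (z₁ z₂ : ℂ) : IsOpen (regularSet L z₁ z₂) := by
  have key : ∀ b : ℂ, IsOpen {z : ℂ | z - b ∉ L.lattice} := fun b =>
    L.isClosed_lattice.isOpen_compl.preimage (continuous_sub_right b)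
  exact (key z₁).inter (key z₂)

theorem isPreconnected_regularSet (L : PeriodPair) (z₁ z₂ : ℂ) :
    IsPreconnected (regularSet L z₁ z₂) := by
  have := PeriodPair.isPreconnected_compl_of_countable (s := (regularSet L z₁ z₂)ᶜ)
    (countable_of_eventually_notMem fun z =>
      (eventually_mem_regularSet L z₁ z₂ z).mono fun w hw => not_not.mpr hw)
  rwa [compl_compl] at this

/-- Local lifts have the same derivative, so `v - v'` is locally constant; on a connected domain one
common value suffices. -/
theorem HasDifferential.eq {D : Set ℂ} (hD : IsOpen D) (hD' : IsPreconnected D)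
    {v v' : D → ℂ ⧸ period} {f : ℂ → ℂ} (h : HasDifferential D v f) (h' : HasDifferential D v' f)
    {z : D} (hz : v z = v' z) : v = v' := by
  have hloc : ∀ z ∈ D, ∃ k : ℂ ⧸ period, ∀ᶠ w in 𝓝 z, ∀ hw : w ∈ D, v ⟨w, hw⟩ = v' ⟨w, hw⟩ + k := by
    intro z hz
    obtain ⟨g, hg⟩ := h z hz
    obtain ⟨g', hg'⟩ := h' z hz
    obtain ⟨r, hr, hball⟩ := Metric.eventually_nhds_iff_ball.mp (hg.and hg')
    refine ⟨((g z - g' z : ℂ) : ℂ ⧸ period), ?_⟩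
    filter_upwards [Metric.ball_mem_nhds z hr] with w hw hwD
    have hd : ∀ y ∈ Metric.ball z r, HasDerivAt (fun y => g y - g' y) 0 y := fun y hy => by
      simpa using (hball y hy).1.1.fun_sub (hball y hy).2.1
    have := Metric.isOpen_ball.is_const_of_deriv_eq_zero Metric.isPreconnected_ball
      (fun y hy => (hd y hy).differentiableAt.differentiableWithinAt)
      (fun y hy => (hd y hy).deriv) hw (Metric.mem_ball_self hr)
    rw [(hball w hw).1.2 hwD, (hball w hw).2.2 hwD, ← QuotientAddGroup.mk_add, ← this,
      add_sub_cancel]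
  have hsub : D ⊆ {w | ∃ hw : w ∈ D, v ⟨w, hw⟩ = v' ⟨w, hw⟩} := by
    refine hD'.subset_of_closure_inter_subset ?_ ⟨z, z.2, z.2, hz⟩ ?_
    · rw [isOpen_iff_mem_nhds]
      rintro y ⟨hy, hvy⟩
      obtain ⟨k, hk⟩ := hloc y hy
      have hk0 := hk.self_of_nhds hy
      rw [hvy, left_eq_add] at hk0
      filter_upwards [hk, hD.mem_nhds hy] with w h1 h2
      exact ⟨h2, by rw [h1 h2, hk0, add_zero]⟩
    · rintro y ⟨hyA, hy⟩
      obtain ⟨k, hk⟩ := hloc y hy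
      obtain ⟨w, hw, hwD, hvw⟩ := mem_closure_iff_nhds.mp hyA _ hk
      have hk0 := hw hwD
      rw [hvw, left_eq_add] at hk0
      exact ⟨hy, by rw [hk.self_of_nhds hy, hk0, add_zero]⟩
  ext w
  exact (hsub w.2).2

/-- Twice the logarithm of an integrating factor of `f / 2` has differential `f dz`. -/
theorem hasDifferential_two_mul_log {D : Set ℂ} (hD : IsOpen D) {P f : ℂ → ℂ}
    (hP : ∀ z ∈ D, P z ≠ 0 ∧ HasDerivAt P (f z / 2 * P z) z) :
    HasDifferential D (fun z => ((2 * Complex.log (P z) : ℂ) : ℂ ⧸ period)) f := by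
  intro z hz
  have hPz := (hP z hz).1
  -- `log P` may jump across the cut, but `P w / P z` is near `1`; the two expressions differ by a
  -- multiple of `4πi`.
  refine ⟨fun w => 2 * (Complex.log (P w / P z) + Complex.log (P z)), ?_⟩
  have hcont : ContinuousAt (fun w => P w / P z) z := (hP z hz).2.continuousAt.div_const _
  have hslit : ∀ᶠ w in 𝓝 z, P w / P z ∈ Complex.slitPlane :=
    hcont.eventually_mem (Complex.isOpen_slitPlane.mem_nhds (by
      rw [div_self hPz]; exact Complex.one_mem_slitPlane))
  filter_upwards [hslit, hD.mem_nhds hz] with w hw hwD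
  obtain ⟨hPw, hdw⟩ := hP w hwD
  refine ⟨?_, fun _ => ?_⟩
  · convert! (((hdw.div_const (P z)).clog hw).add_const (Complex.log (P z))).const_mul 2 using 1
    field_simp
  · rw [coe_eq_coe_period_iff, mul_div_cancel_left₀ _ two_ne_zero,
      mul_div_cancel_left₀ _ two_ne_zero, Complex.exp_add, Complex.exp_log hPw,
      Complex.exp_log (div_ne_zero hPw hPz), Complex.exp_log hPz, div_mul_cancel₀ _ hPz]

theorem eq_exp_half_of_hasDerivAt {I : Set ℝ} (hI : IsOpen I) (hI' : IsPreconnected I)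
    {u Ω : ℝ → ℝ} {R : ℝ → ℂ} (hu : ∀ s ∈ I, HasDerivAt u (Ω s) s)
    (hR : ∀ s ∈ I, HasDerivAt R (Ω s / 2 * R s) s) {s₀ : ℝ} (hs₀ : s₀ ∈ I)
    (h : R s₀ = Complex.exp (u s₀ / 2)) {s : ℝ} (hs : s ∈ I) : R s = Complex.exp (u s / 2) := by
  have hd : ∀ s ∈ I, HasDerivAt (fun s => R s / Complex.exp (u s / 2)) 0 s := by
    intro s hs
    convert! (hR s hs).div (((hu s hs).ofReal_comp.div_const 2).cexp) (Complex.exp_ne_zero _) using 1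
    ring
  have := hI.is_const_of_deriv_eq_zero hI'
    (fun y hy => (hd y hy).differentiableAt.differentiableWithinAt)
    (fun y hy => (hd y hy).deriv) hs hs₀
  simp only [h, div_self (Complex.exp_ne_zero _)] at this
  exact (div_eq_one_iff_eq (Complex.exp_ne_zero _)).mp this

end Schwarzschild

end

/-! ### Assembly of the main theorem. -/

theorem mainTheorem2 (I : Set ℝ) (hI_open : IsOpen I) (hI_conn : IsPreconnected I)
    (u ω U Ω : ℝ → ℝ) (x p : ℝ → EuclideanSpace ℝ (Fin 3))
    (hgeo : Schwarzschild.IsNullGeodesic I u ω U Ω x p)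
    (s₀ : ℝ) (hs₀ : s₀ ∈ I) (H U₀ : ℝ)
    (hH : Schwarzschild.stringHamiltonian (u s₀) (ω s₀) (U s₀) (Ω s₀) = H) (hU : U s₀ = U₀)
    (hgen : Schwarzschild.Generic H U₀) :
    ∃ (L : PeriodPair) (z₀ z₁ z₂ : ℂ) (F : ℂ → ℂ),
      -- the Weierstrass parametrization: `ω = ℘(z - z₀; g₂, g₃)` and `dω/dz = ℘'(z - z₀; g₂, g₃)`
      L.g₂ = 4 / 3 ∧
      L.g₃ = (8 * H - 54 * U₀ ^ 2) / (27 * H) ∧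
      (∀ s ∈ I,
        Schwarzschild.zParam H s - z₀ ∉ L.lattice ∧
        (ω s : ℂ) = L.weierstrassP (Schwarzschild.zParam H s - z₀) ∧
        ((deriv ω s : ℝ) : ℂ) =
          (√(H / 2) : ℝ) * L.derivWeierstrassP (Schwarzschild.zParam H s - z₀)) ∧
      -- `du = Ω ds` is the restriction of the meromorphic one-form `F dz` on the elliptic curve
      Schwarzschild.HasSimpleAndDoublePole L F z₁ z₂ ∧
      (∀ s ∈ I,
        Schwarzschild.zParam H s ∈ Schwarzschild.regularSet L z₁ z₂ ∧
        (Ω s : ℂ) = F (Schwarzschild.zParam H s) * (√(H / 2) : ℝ)) ∧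
      -- `u` is a well-defined function `v` of `z` with values in `ℂ / 4πiℤ`, and `exp (u / 2)` is
      -- a well-defined function of `z`, holomorphic off the double poles of `du`
      ∃ v : Schwarzschild.regularSet L z₁ z₂ → ℂ ⧸ Schwarzschild.period,
        Schwarzschild.IsContinuation I H u (Schwarzschild.regularSet L z₁ z₂) F v ∧
        (∀ v', Schwarzschild.IsContinuation I H u (Schwarzschild.regularSet L z₁ z₂) F v' →
          v' = v) ∧
        ∃ P : ℂ → ℂ,
          DifferentiableOn ℂ P {z | z - z₂ ∉ L.lattice} ∧
          (∀ (z : Schwarzschild.regularSet L z₁ z₂) (a : ℂ),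
            (a : ℂ ⧸ Schwarzschild.period) = v z → P z = Complex.exp (a / 2)) ∧
          (∀ s ∈ I, P (Schwarzschild.zParam H s) = Complex.exp ((u s : ℂ) / 2)) := by
  obtain ⟨hHpos, hU0, hdisc⟩ := hgen
  set κ : ℝ := √(H / 2) with hκdef
  have hκpos : 0 < κ := Real.sqrt_pos.mpr (half_pos hHpos)
  have hκ : κ ≠ 0 := hκpos.ne'
  have hκH : κ ^ 2 = H / 2 := Real.sq_sqrt (half_pos hHpos).le
  have hκC : (κ : ℂ) ≠ 0 := by exact_mod_cast hκ
  have hHs : ∀ s ∈ I, Schwarzschild.stringHamiltonian (u s) (ω s) (U s) (Ω s) = H :=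
    fun s hs => (hgeo.energy_eq hI_open hI_conn hs hs₀).trans hH
  have hUs : ∀ s ∈ I, U s = U₀ := fun s hs => (hgeo.momentum_eq hI_open hI_conn hs hs₀).trans hU
  have hg₃c : ((8 * H - 54 * U₀ ^ 2) / (27 * H) : ℝ) = 8 / 27 - (U₀ / κ) ^ 2 := by
    rw [div_pow, hκH]
    field_simp
    ring
  -- Up to a nonzero factor the discriminant `64 - 729g₃²` is `U₀²(8H - 27U₀²)`, so genericity is
  -- nonsingularity of the cubic.
  obtain ⟨L, hg₂, hg₃⟩ := exists_periodPair_g₂_eq_g₃_eq ((8 * H - 54 * U₀ ^ 2) / (27 * H)) (by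
    intro h
    field_simp at h
    have h1 : U₀ ^ 2 * (8 * H - 27 * U₀ ^ 2) = 0 := by linarith
    exact mul_ne_zero (pow_ne_zero 2 hU0) hdisc h1)
  set c : ℂ := ((U₀ / κ : ℝ) : ℂ) with hcdef
  have hg₃' : L.g₃ = 8 / 27 - c ^ 2 := by
    rw [hg₃, hg₃c, hcdef]
    push_cast
    rfl
  have hc : c ≠ 0 := by
    rw [hcdef]
    exact_mod_cast div_ne_zero hU0 hκ
  obtain ⟨a₁, a₂, ha⟩ := PeriodPair.exists_isZeroPair hg₂ hg₃' hc
  obtain ⟨w₀, hw₀, hw₁, hw₂⟩ := L.exists_weierstrassP_eq_and_derivWeierstrassP_eq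
    (x := ω s₀) (y := ((U s₀ + 2 * Schwarzschild.Q (ω s₀) * Ω s₀) / κ : ℝ)) (by
      rw [hg₂, hg₃']
      have hE := hHs s₀ hs₀
      rw [Schwarzschild.stringHamiltonian, hU] at hE
      have hreal : ((U₀ + 2 * Schwarzschild.Q (ω s₀) * Ω s₀) / κ) ^ 2 =
          4 * ω s₀ ^ 3 - 4 / 3 * ω s₀ - (8 / 27 - (U₀ / κ) ^ 2) := by
        rw [div_pow, div_pow, hκH, div_eq_iff (half_pos hHpos).ne']
        have hX : U₀ ^ 2 / (H / 2) * (H / 2) = U₀ ^ 2 := div_mul_cancel₀ _ (half_pos hHpos).ne'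
        have hQ : 4 * ω s₀ ^ 3 - 4 / 3 * ω s₀ - 8 / 27 = 8 * Schwarzschild.Q (ω s₀) := by
          rw [Schwarzschild.Q]
          ring
        linear_combination 4 * Schwarzschild.Q (ω s₀) * hE - H / 2 * hQ - hX
      rw [hU, hcdef]
      have := congrArg Complex.ofReal hreal
      push_cast at this ⊢
      exact this)
  -- The shift that places the geodesic at time `s₀` over `w₀`, the preimage of its initial data on
  -- the cubic.
  set z₀ : ℂ := s₀ * κ - w₀ with hz₀
  have hz : ∀ s : ℝ, Schwarzschild.zParam H s - z₀ = s * κ + (w₀ - s₀ * κ) := fun s => by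
    rw [Schwarzschild.zParam, ← hκdef, hz₀]
    push_cast
    ring
  have hW : ∀ s ∈ I, Schwarzschild.zParam H s - z₀ ∉ L.lattice ∧
      L.weierstrassP (Schwarzschild.zParam H s - z₀) = ω s ∧
      L.derivWeierstrassP (Schwarzschild.zParam H s - z₀) =
        ((U₀ + 2 * Schwarzschild.Q (ω s) * Ω s) / κ : ℝ) := by
    intro s hs
    rw [hz, ← hUs s hs]
    exact hgeo.weierstrassP_eq hI_open hI_conn hκ hκH hg₂ hHs hs₀
      (by simpa using hw₀) (by simpa using hw₁) (by simpa using hw₂) hs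
  -- This is `Ω(dω/ds + U) = 2H = 4κ²` divided by `κ`. It yields the formula for `F` and, as `κ ≠
  -- 0`, shows that the geodesic avoids the poles.
  have hsum : ∀ s ∈ I, (Ω s * (L.derivWeierstrassP (Schwarzschild.zParam H s - z₀) + c) : ℂ) =
      4 * κ := by
    intro s hs
    rw [(hW s hs).2.2, hcdef]
    have hE := hHs s hs
    rw [Schwarzschild.stringHamiltonian, hUs s hs] at hE
    have : Ω s * ((U₀ + 2 * Schwarzschild.Q (ω s) * Ω s) / κ + U₀ / κ) = 4 * κ := by
      field_simp
      linear_combination 2 * hE - 4 * hκH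
    exact_mod_cast this
  have hne : ∀ s ∈ I, L.derivWeierstrassP (Schwarzschild.zParam H s - z₀) + c ≠ 0 := by
    intro s hs h0
    have := hsum s hs
    rw [h0, mul_zero] at this
    exact mul_ne_zero (by norm_num) hκC this.symm
  have hreg : ∀ s ∈ I, Schwarzschild.zParam H s ∈
      Schwarzschild.regularSet L (z₀ + a₁) (z₀ + a₂) := by
    intro s hs
    constructor <;> intro h <;> rw [← sub_sub] at h <;> apply hne s hs
    · rw [(PeriodPair.weierstrassP_eq_of_sub_mem h).2, ha.deriv₁, neg_add_cancel]
    · rw [(PeriodPair.weierstrassP_eq_of_sub_mem h).2, ha.deriv₂, neg_add_cancel]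
  have hΩF : ∀ s ∈ I, (Ω s : ℂ) = L.fourDivDeriv c (Schwarzschild.zParam H s - z₀) * κ := by
    intro s hs
    rw [PeriodPair.fourDivDeriv_of_notMem (hW s hs).1, div_mul_eq_mul_div, eq_div_iff (hne s hs),
      hsum s hs]
  obtain ⟨P, hP₀, hPd, hP⟩ := ha.exists_integratingFactor z₀ (hreg s₀ hs₀)
    (Complex.exp_ne_zero ((u s₀ : ℂ) / 2))
  have hPu : ∀ s ∈ I, P (Schwarzschild.zParam H s) = Complex.exp ((u s : ℂ) / 2) := by
    intro s hs
    refine Schwarzschild.eq_exp_half_of_hasDerivAt hI_open hI_conn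
      (R := fun s => P (Schwarzschild.zParam H s))
      (fun s hs => hgeo.hasDerivAt_u hs) (fun s hs => ?_) hs₀ hP₀ hs
    have hline : HasDerivAt (fun s : ℝ => Schwarzschild.zParam H s) κ s := by
      have h := ((hasDerivAt_id s).mul_const κ).ofReal_comp
      rwa [one_mul] at h
    convert! (hP _ (hreg s hs)).2.comp s hline using 1
    rw [hΩF s hs]
    ring
  have hopen := Schwarzschild.isOpen_regularSet L (z₀ + a₁) (z₀ + a₂)
  have hcont : Schwarzschild.IsContinuation I H u (Schwarzschild.regularSet L (z₀ + a₁) (z₀ + a₂))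
      (fun z => L.fourDivDeriv c (z - z₀)) (fun z => ((2 * Complex.log (P z) : ℂ))) := by
    refine ⟨Schwarzschild.hasDifferential_two_mul_log hopen hP, fun s hs => ⟨hreg s hs, ?_⟩⟩
    rw [Schwarzschild.coe_eq_coe_period_iff, mul_div_cancel_left₀ _ two_ne_zero,
      Complex.exp_log (hP _ (hreg s hs)).1, hPu s hs]
  refine ⟨L, z₀, z₀ + a₁, z₀ + a₂, fun z => L.fourDivDeriv c (z - z₀), hg₂, ?_, ?_,
    ha.hasSimpleAndDoublePole z₀, fun s hs => ⟨hreg s hs, hΩF s hs⟩, _, hcont, ?_, P, hPd, ?_, hPu⟩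
  · rw [hg₃]
    push_cast
    rfl
  · intro s hs
    refine ⟨(hW s hs).1, (hW s hs).2.1.symm, ?_⟩
    rw [(hW s hs).2.2, (hgeo.hasDerivAt_ω hs).deriv, hUs s hs, ← Complex.ofReal_mul,
      mul_div_cancel₀ _ hκ]
  · intro v' hv'
    obtain ⟨h1, h2⟩ := hv'.2 s₀ hs₀
    obtain ⟨h3, h4⟩ := hcont.2 s₀ hs₀
    exact hv'.1.eq hopen (Schwarzschild.isPreconnected_regularSet L _ _) hcont.1
      (z := ⟨_, h1⟩) (h2.trans h4.symm)
  · intro z a hza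
    rw [Schwarzschild.coe_eq_coe_period_iff, mul_div_cancel_left₀ _ two_ne_zero,
      Complex.exp_log (hP z z.2).1] at hza
    exact hza.symm
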